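/- Let $\mathbb{S}^2\subset\mathbb{R}^3$ be the unit sphere with its surface measure $dS$ and outward unit normal $n$, and let $H^1(T\mathbb{S}^2)$ be the space of real tangent vector fields on $\mathbb{S}^2$ that belong to $L^2(T\mathbb{S}^2)$ together with their weak covariant derivative. For $u\in H^1(T\mathbb{S}^2)$ let $\operatorname{div}u$ be the trace of the weak covariant derivative of $u$ and let $\operatorname{rot}u:=-\operatorname{div}(n\times u)$; $\|\cdot\|$ denotes the norm of $L^2(\mathbb{S}^2)$. Let $u_1,\dots,u_N\in H^1(T\mathbb{S}^2)$ be orthonormal in $L^2(T\mathbb{S}^2)$, and let $\rho(s)=\sum_{j=1}^N|u_j(s)|^2$. Then $\rho\in L^2(\mathbb{S}^2)$ and $$\int_{\mathbb{S}^2}\rho(s)^2\,dS\le\frac{9}{2\pi}\sum_{j=1}^N\bigl(\|\operatorname{rot}u_j\|^2+\|\operatorname{div}u_j\|^2\bigr).$$ If, in addition, $\operatorname{div}u_j=0$ for all $j$, then $$\int_{\mathbb{S}^2}\rho(s)^2\,dS\le\frac{9}{4\pi}\sum_{j=1}^N\|\operatorname{rot}u_j\|^2;$$ if, in addition, $\operatorname{rot}u_j=0$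 for all $j$, then $$\int_{\mathbb{S}^2}\rho(s)^2\,dS\le\frac{9}{4\pi}\sum_{j=1}^N\|\operatorname{div}u_j\|^2.$$ -/

import Mathlib

open MeasureTheory
open scoped ContDiff

noncomputable section

namespace SphereLT

/-- Euclidean three-space. -/
abbrev E3 : Type := EuclideanSpace ℝ (Fin 3)

/-- The unit sphere of Euclidean three-space. -/
abbrev S2 : Type := Metric.sphere (0 : E3) 1

/-- The surface measure on the unit sphere (total mass `4π`). -/
abbrev area : Measure S2 := (volume : Measure E3).toSphere

/-- The cross product on `E3`. -/
def cross (v w : E3) : E3 :=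
  WithLp.toLp 2 (crossProduct (WithLp.ofLp v) (WithLp.ofLp w))

/-- The projection `v ↦ v - (s · v) s`; for a unit vector `s` this is the orthogonal projection
onto the tangent plane of the sphere at `s`. -/
def tangentProj (s : E3) : E3 →L[ℝ] E3 :=
  ContinuousLinearMap.id ℝ E3 - (innerSL ℝ s).smulRight s

/-- A smooth tangent vector field on the sphere, given through a smooth extension to `E3`. -/
structure IsSmoothTangent (X : E3 → E3) : Prop where
  smooth : ContDiff ℝ ∞ X
  tangent : ∀ s : S2, inner ℝ (X s) (s : E3) = 0

/-- The Levi-Civita covariant derivative at `s` of a smooth tangent field `X`, that is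
`v ↦ ∇_v X = P (D X (s) v)` for `v` tangent at `s`, extended by `0` to the normal direction.
At points of the sphere it depends only on the restriction of `X` to the sphere. -/
def covDeriv (X : E3 → E3) (s : E3) : E3 →L[ℝ] E3 :=
  (tangentProj s).comp ((fderiv ℝ X s).comp (tangentProj s))

/-- The surface divergence of a smooth tangent field: the trace of its covariant derivative. -/
def smoothDiv (X : E3 → E3) (s : E3) : ℝ :=
  LinearMap.trace ℝ E3 (covDeriv X s : E3 →ₗ[ℝ] E3)

/-- `A` is a weak covariant derivative in `L²` of the tangent field `u`: a square integrable
field of endomorphisms of the tangent planes (extended by `0` to the normal direction) with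
`∫ ⟨A X, Y⟩ = - ∫ ⟨u, ∇_X Y + (div X) Y⟩` for all smooth tangent vector fields `X`, `Y`. -/
structure IsWeakCovDeriv (u : S2 → E3) (A : S2 → E3 →L[ℝ] E3) : Prop where
  memLp : MemLp A 2 area
  map_normal : ∀ᵐ s ∂area, A s (s : E3) = 0
  map_tangent : ∀ᵐ s ∂area, ∀ v : E3, inner ℝ (A s v) (s : E3) = 0
  integral_eq : ∀ X Y : E3 → E3, IsSmoothTangent X → IsSmoothTangent Y →
    ∫ s, inner ℝ (A s (X s)) (Y s) ∂area =
      - ∫ s, inner ℝ (u s) (covDeriv Y s (X s) + smoothDiv X s • Y s) ∂area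

/-- The Sobolev space `H¹(TS²)`: square integrable tangent vector fields with a square integrable
weak covariant derivative. -/
structure MemH1 (u : S2 → E3) : Prop where
  memLp : MemLp u 2 area
  tangent : ∀ᵐ s ∂area, inner ℝ (u s) (s : E3) = 0
  exists_weakCovDeriv : ∃ A, IsWeakCovDeriv u A

open Classical in
/-- The weak covariant derivative of a field in `H¹(TS²)` (unique almost everywhere). -/
def weakCovDeriv (u : S2 → E3) : S2 → E3 →L[ℝ] E3 :=
  if h : ∃ A, IsWeakCovDeriv u A then h.choose else 0

/-- The divergence of a field in `H¹(TS²)`: the trace of its weak covariant derivative. -/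
def div (u : S2 → E3) (s : S2) : ℝ :=
  LinearMap.trace ℝ E3 (weakCovDeriv u s : E3 →ₗ[ℝ] E3)

/-- The scalar curl `rot u = - div (n × u)` of a field in `H¹(TS²)`, where `n` is the outward unit
normal, which at the point `s` is the vector `s`. -/
def rot (u : S2 → E3) (s : S2) : ℝ :=
  - div (fun t : S2 => cross (t : E3) (u t)) s

/-- The square of the `L²(S²)` norm of a scalar function. -/
def normSq (f : S2 → ℝ) : ℝ := ∫ s, f s ^ 2 ∂area

/-- The family `u` is orthonormal in `L²(TS²)`. -/
def IsOrthonormal {N : ℕ} (u : Fin N → S2 → E3) : Prop :=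
  ∀ i j, ∫ s, inner ℝ (u i s) (u j s) ∂area = if i = j then 1 else 0

/-- The density `ρ = ∑ |u_j|²`. -/
def density {N : ℕ} (u : Fin N → S2 → E3) (s : S2) : ℝ := ∑ j, ‖u j s‖ ^ 2

end SphereLT

end

/-! The proof is Rumin's argument for Lieb-Thirring inequalities, run along the filtration of
tangent fields by the degree of vector spherical harmonics. These come in two kinds, gradients and
rotated gradients of scalar spherical harmonics.

Let `S m` collect the projections of all `u j` to degree at most `m`, using one or both kinds.
Bessel's inequality for the orthonormal family (`sum_norm_sq_harmSum_le`) and the addition formula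
(`sum_norm_sq_vecHarm_le`) give `|S m|² ≤ b m (m + 2)` pointwise, where `b` is the number of kinds
divided by `4π`. Hence `|S D - S m| ≥ (|S D| - √(b m (m + 2)))₊`. Squaring and summing over `m` with
weights `2 (m + 1)` bounds `|S D|⁴` from above (`pow_four_le_sum`, with constant `9 b`). After
integration the weights add up to `∑_{m ≤ n} 2 (m + 1) = (n + 1)(n + 2)`, the Laplace eigenvalue, so
the right side is the energy of the projections (`sum_mul_sum_sdiff`). Fatou's lemma removes the
cutoff `D`. Two kinds give `9 / (2π)`; if the divergence or the rotation vanishes, one kind suffices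
and gives `9 / (4π)`.

The harmonic analysis is done with polynomials modulo those vanishing on the sphere. Differentiation
uses only the angular derivatives `L = x × ∇`, which are skew-adjoint by rotation invariance.
Completeness of the vector harmonics follows from a polynomial Hodge decomposition
(`exists_potentials`) and Stone-Weierstrass. The weak divergence and rotation enter only through
their integrals against polynomials (`MemH1.integral_div_mul`, `MemH1.integral_rot_mul`). -/

noncomputable section

namespace SphereLT

open MvPolynomial Module Filter Topology

/-! ### Polynomials and angular derivatives -/

/-- Real polynomials in the three coordinates of `E3`. -/
abbrev Poly : Type := MvPolynomial (Fin 3) ℝ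

/-- The value of a polynomial at a point of `E3`. -/
abbrev pev (p : Poly) (x : E3) : ℝ := MvPolynomial.eval x.ofLp p

/-- The components of the angular derivative `x × ∇`. -/
def angular (i : Fin 3) : Derivation ℝ Poly Poly :=
  (X (i + 1) : Poly) • pderiv (i + 2) - (X (i + 2) : Poly) • pderiv (i + 1)

theorem angular_apply (i : Fin 3) (p : Poly) :
    angular i p = X (i + 1) * pderiv (i + 2) p - X (i + 2) * pderiv (i + 1) p := by
  simp [angular]

/-- The `i`-th coordinate function of `E3`. -/
abbrev coord (i : Fin 3) : E3 →L[ℝ] ℝ := EuclideanSpace.proj i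

theorem pev_mul_X (p : Poly) (i : Fin 3) : pev (p * X i) = fun y => pev p y * coord i y := by
  ext y; simp [pev]

theorem hasFDerivAt_pev (p : Poly) (x : E3) :
    HasFDerivAt (pev p) (∑ i, pev (pderiv i p) x • coord i) x := by
  induction p using MvPolynomial.induction_on with
  | C a =>
    have e : pev (C a) = fun _ => a := by ext y; simp [pev]
    rw [e]
    refine (hasFDerivAt_const a x).congr_fderiv ?_
    simp
  | add p q hp hq =>
    have e : pev (p + q) = fun y => pev p y + pev q y := by ext y; simp [pev]
    rw [e]
    refine (hp.add hq).congr_fderiv ?_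
    rw [← Finset.sum_add_distrib]
    simp [pev, add_smul]
  | mul_X p i hp =>
    rw [pev_mul_X]
    refine (hp.mul (coord i).hasFDerivAt).congr_fderiv ?_
    ext v
    fin_cases i <;>
    simp [pev, pderiv_X, Fin.sum_univ_three, Pi.single_apply, mul_comm] <;> ring

theorem contDiff_pev (p : Poly) : ContDiff ℝ ∞ (pev p) := by
  induction p using MvPolynomial.induction_on with
  | C a =>
    have e : pev (C a) = fun _ => a := by ext y; simp [pev]
    rw [e]; exact contDiff_const
  | add p q hp hq =>
    have e : pev (p + q) = fun y => pev p y + pev q y := by ext y; simp [pev]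
    rw [e]; exact hp.add hq
  | mul_X p i hp =>
    rw [pev_mul_X]; exact hp.mul (coord i).contDiff

@[fun_prop]
theorem continuous_pev (p : Poly) : Continuous (pev p) := (contDiff_pev p).continuous

@[fun_prop]
theorem continuous_pev_sphere (p : Poly) : Continuous (fun s : S2 => pev p (s : E3)) :=
  (continuous_pev p).comp continuous_subtype_val

/-! ### Rotation invariance and integration by parts on the sphere -/

theorem integrable_of_continuous {F : Type*} [NormedAddCommGroup F] {f : S2 → F}
    (hf : Continuous f) : Integrable f area := by
  exact hf.integrable_of_hasCompactSupport (HasCompactSupport.of_compactSpace f)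

/-- The action of a linear isometry on the unit sphere. -/
def sphereMap (R : E3 ≃ₗᵢ[ℝ] E3) (s : S2) : S2 :=
  ⟨R s, by simp⟩

theorem continuous_sphereMap (R : E3 ≃ₗᵢ[ℝ] E3) : Continuous (sphereMap R) := by
  unfold sphereMap
  fun_prop

open Pointwise in
theorem measurePreserving_sphereMap (R : E3 ≃ₗᵢ[ℝ] E3) :
    MeasurePreserving (sphereMap R) area area := by
  refine ⟨(continuous_sphereMap R).measurable, ?_⟩
  ext A hA
  rw [Measure.map_apply (continuous_sphereMap R).measurable hA,
    Measure.toSphere_apply' _ hA,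
    Measure.toSphere_apply' _ ((continuous_sphereMap R).measurable hA)]
  congr 1
  -- The surface measure of a set is a multiple of the volume of the cone over it, and a linear
  -- isometry carries cones to cones.
  have hp : MeasurePreserving R.toMeasurableEquiv (volume : Measure E3) volume :=
    R.measurePreserving
  rw [← hp.measure_preimage_equiv (Set.Ioo (0 : ℝ) 1 • ((↑) '' A : Set E3))]
  congr 1
  ext x
  simp only [Set.mem_smul, Set.mem_image, Set.mem_preimage]
  constructor
  · rintro ⟨c, hc, _, ⟨s, hs, rfl⟩, h⟩
    refine ⟨c, hc, _, ⟨_, hs, rfl⟩, ?_⟩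
    have h' : c • (s : E3) = x := h
    change c • R s = R x
    simp [← h']
  · rintro ⟨c, hc, _, ⟨s, hs, rfl⟩, h⟩
    refine ⟨c, hc, R.symm s, ⟨⟨R.symm s, by simp⟩, ?_, rfl⟩, ?_⟩
    · simpa [sphereMap] using hs
    · apply R.injective
      have h' : c • (s : E3) = R x := h
      simpa using h'

/-- The rotation by the angle `t` about the `i`-th coordinate axis, as a function. -/
def rotFun (i : Fin 3) (t : ℝ) (x : E3) : E3 :=
  WithLp.toLp 2 fun j => if j = i then x i else
    if j = i + 1 then Real.cos t * x (i + 1) - Real.sin t * x (i + 2)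
    else Real.sin t * x (i + 1) + Real.cos t * x (i + 2)

theorem norm_rotFun (i : Fin 3) (t : ℝ) (x : E3) : ‖rotFun i t x‖ = ‖x‖ := by
  have h := Real.sin_sq_add_cos_sq t
  rw [← sq_eq_sq₀ (norm_nonneg _) (norm_nonneg _), EuclideanSpace.norm_sq_eq,
    EuclideanSpace.norm_sq_eq]
  fin_cases i <;> simp [rotFun, Fin.sum_univ_three]
  · linear_combination (x 1 ^ 2 + x 2 ^ 2) * h
  · linear_combination (x 2 ^ 2 + x 0 ^ 2) * h
  · linear_combination (x 0 ^ 2 + x 1 ^ 2) * h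

/-- The rotation by the angle `t` about the `i`-th coordinate axis. -/
def rotation (i : Fin 3) (t : ℝ) : E3 ≃ₗᵢ[ℝ] E3 :=
  LinearIsometry.toLinearIsometryEquiv
    ({ toFun := rotFun i t
       map_add' := fun x y => by
        ext j; simp only [rotFun, PiLp.add_apply]; split_ifs <;> ring
       map_smul' := fun c x => by
        ext j; simp only [rotFun, PiLp.smul_apply, smul_eq_mul, RingHom.id_apply]
        split_ifs <;> ring
       norm_map' := norm_rotFun i t } : E3 →ₗᵢ[ℝ] E3) rfl

theorem coe_sphereMap_rotation (i : Fin 3) (t : ℝ) (s : S2) :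
    (sphereMap (rotation i t) s : E3) = rotFun i t s := rfl

theorem hasDerivAt_pev_rotFun (p : Poly) (i : Fin 3) (x : E3) (t : ℝ) :
    HasDerivAt (fun t => pev p (rotFun i t x)) (pev (angular i p) (rotFun i t x)) t := by
  have hr : HasDerivAt (fun t => rotFun i t x) (WithLp.toLp 2 fun j => if j = i then 0 else
      if j = i + 1 then - rotFun i t x (i + 2) else rotFun i t x (i + 1)) t := by
    refine ((PiLp.continuousLinearEquiv 2 ℝ fun _ : Fin 3 => ℝ).symm.hasFDerivAt).comp_hasDerivAt t
      (hasDerivAt_pi.2 fun j => ?_)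
    have hs := Real.hasDerivAt_sin t
    have hc := Real.hasDerivAt_cos t
    have h1 := (hc.mul_const (x (i + 1))).sub (hs.mul_const (x (i + 2)))
    have h2 := (hs.mul_const (x (i + 1))).add (hc.mul_const (x (i + 2)))
    have h0 := hasDerivAt_const t (x i)
    fin_cases i <;> fin_cases j <;> simp [rotFun] at h0 h1 h2 ⊢
    all_goals first | exact h0 | exact h1.congr_deriv (by ring) | exact h2.congr_deriv (by ring)
  have h := (hasFDerivAt_pev p (rotFun i t x)).comp_hasDerivAt t hr
  refine h.congr_deriv ?_
  rw [angular_apply]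
  fin_cases i <;> simp [Fin.sum_univ_three] <;> ring

/-- The integral of a polynomial over the sphere. -/
def sphereInt (p : Poly) : ℝ := ∫ s : S2, pev p s ∂area

theorem integral_deriv_eq_zero_of_integral_const {Ω : Type*} [MeasurableSpace Ω] {μ : Measure Ω}
    [IsFiniteMeasure μ] {F F' : ℝ → Ω → ℝ} {C c : ℝ} (hF : ∀ t, Integrable (F t) μ)
    (hF' : AEStronglyMeasurable (F' 0) μ) (hb : ∀ s t, |F' t s| ≤ C)
    (hd : ∀ s t, HasDerivAt (fun t => F t s) (F' t s) t) (hc : ∀ t, ∫ s, F t s ∂μ = c) :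
    ∫ s, F' 0 s ∂μ = 0 := by
  have h := hasDerivAt_integral_of_dominated_loc_of_deriv_le (μ := μ) (x₀ := (0 : ℝ))
    (F := F) (F' := F') (bound := fun _ => C)
    (s := Set.univ) Filter.univ_mem
    (Filter.Eventually.of_forall fun t => (hF t).aestronglyMeasurable)
    (hF 0) hF'
    (Filter.Eventually.of_forall fun s t _ => hb s t) (integrable_const _)
    (Filter.Eventually.of_forall fun s t _ => hd s t)
  have h' := h.2
  rw [funext hc] at h'
  exact h'.unique (hasDerivAt_const _ _)

theorem integral_pev_rotFun (q : Poly) (i : Fin 3) (t : ℝ) :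
    ∫ s : S2, pev q (rotFun i t s) ∂area = sphereInt q := by
  have hm := measurePreserving_sphereMap (rotation i t)
  have h := integral_map (μ := area) hm.measurable.aemeasurable (f := fun s : S2 => pev q s)
    (continuous_pev_sphere q).aestronglyMeasurable
  rw [hm.map_eq] at h
  unfold sphereInt
  simpa only [coe_sphereMap_rotation] using h.symm

theorem continuous_pev_rotFun (q : Poly) (i : Fin 3) (t : ℝ) :
    Continuous fun s : S2 => pev q (rotFun i t s) := by
  have h := (continuous_pev_sphere q).comp (continuous_sphereMap (rotation i t))
  simpa only [Function.comp_def, coe_sphereMap_rotation] using h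

/-- `angular i p` is the derivative of `p` along the rotations about the `i`-th axis, and these do
not change the integral. -/
theorem sphereInt_angular (i : Fin 3) (p : Poly) : sphereInt (angular i p) = 0 := by
  obtain ⟨C, hC⟩ := (isCompact_sphere (0 : E3) 1).exists_bound_of_continuousOn
    (continuous_pev (angular i p)).continuousOn
  have hb (s : S2) (t : ℝ) : |pev (angular i p) (rotFun i t s)| ≤ C :=
    hC _ (by simp [norm_rotFun])
  rw [← integral_pev_rotFun (angular i p) i 0]
  exact integral_deriv_eq_zero_of_integral_const
    (F := fun t (s : S2) => pev p (rotFun i t s))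
    (F' := fun t (s : S2) => pev (angular i p) (rotFun i t s))
    (fun t => integrable_of_continuous (continuous_pev_rotFun p i t))
    (continuous_pev_rotFun _ i 0).aestronglyMeasurable hb
    (fun s t => hasDerivAt_pev_rotFun p i s t) (fun t => integral_pev_rotFun p i t)

theorem integrable_pev (p : Poly) : Integrable (fun s : S2 => pev p s) area :=
  integrable_of_continuous (continuous_pev_sphere p)

/-- Integration over the sphere as a linear functional on polynomials. -/
def sphereIntₗ : Poly →ₗ[ℝ] ℝ where
  toFun := sphereInt
  map_add' p q := by
    simp only [sphereInt, pev, map_add]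
    exact integral_add (integrable_pev p) (integrable_pev q)
  map_smul' c p := by
    simp only [sphereInt, pev, smul_eval, RingHom.id_apply, smul_eq_mul]
    exact integral_const_mul c _

theorem sphereInt_add (p q : Poly) : sphereInt (p + q) = sphereInt p + sphereInt q :=
  map_add sphereIntₗ p q

theorem sphereInt_sub (p q : Poly) : sphereInt (p - q) = sphereInt p - sphereInt q :=
  map_sub sphereIntₗ p q

theorem sphereInt_smul (c : ℝ) (p : Poly) : sphereInt (c • p) = c * sphereInt p :=
  map_smul sphereIntₗ c p

theorem sphereInt_sum {ι : Type*} (t : Finset ι) (p : ι → Poly) :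
    sphereInt (∑ i ∈ t, p i) = ∑ i ∈ t, sphereInt (p i) :=
  map_sum sphereIntₗ p t

theorem sphereInt_mul_angular (i : Fin 3) (p q : Poly) :
    sphereInt (p * angular i q) = -sphereInt (angular i p * q) := by
  have h := sphereInt_angular i (p * q)
  rw [Derivation.leibniz, smul_eq_mul, smul_eq_mul, sphereInt_add, mul_comm q] at h
  linarith

/-! ### Functions on the sphere as polynomials modulo an ideal; the Laplacian -/

/-- The polynomials which vanish on the sphere. -/
def sphereIdeal : Ideal Poly where
  carrier := {p | ∀ s : S2, pev p s = 0}
  add_mem' hp hq s := by simp [hp s, hq s]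
  zero_mem' s := by simp
  smul_mem' c p hp s := by simp [hp s]

theorem sphereInt_congr {p q : Poly} (h : p - q ∈ sphereIdeal) : sphereInt p = sphereInt q := by
  refine integral_congr_ae (Filter.Eventually.of_forall fun s => ?_)
  have := h s
  simpa [sub_eq_zero] using this

theorem sphereInt_eq_zero {p : Poly} (h : p ∈ sphereIdeal) : sphereInt p = 0 := by
  rw [sphereInt_congr (q := 0) (by simpa using h)]
  exact map_zero sphereIntₗ

theorem sphereInt_mul_self_nonneg (p : Poly) : 0 ≤ sphereInt (p * p) :=
  integral_nonneg fun s => by simpa using mul_self_nonneg _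

/-- A continuous function vanishing almost everywhere vanishes, since the surface measure charges
every nonempty open set. This turns integral identities into membership in the ideal. -/
theorem mem_sphereIdeal_of_sphereInt_mul_self {p : Poly} (h : sphereInt (p * p) = 0) :
    p ∈ sphereIdeal := by
  have hc : Continuous fun s : S2 => pev (p * p) s := continuous_pev_sphere _
  have h0 := (integral_eq_zero_iff_of_nonneg
    (fun s : S2 => by simpa using mul_self_nonneg (pev p s)) (integrable_pev (p * p))).1 h
  have h1 := (hc.ae_eq_iff_eq area continuous_const).1 h0
  intro s
  have h2 : pev (p * p) s = 0 := congrFun h1 s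
  exact mul_self_eq_zero.1 (by simpa using h2)

/-- Integration by parts gives `∫ (L p)² = -∫ (L L p) p = 0`. Thus `L` descends to functions on the
sphere. -/
theorem angular_mem_sphereIdeal (i : Fin 3) {p : Poly} (hp : p ∈ sphereIdeal) :
    angular i p ∈ sphereIdeal := by
  refine mem_sphereIdeal_of_sphereInt_mul_self ?_
  rw [sphereInt_mul_angular, sphereInt_eq_zero (Ideal.mul_mem_left _ _ hp), neg_zero]

/-- The Laplace-Beltrami operator of the sphere, as an operator on polynomials. -/
def lap : Poly →ₗ[ℝ] Poly := ∑ i, (angular i : Poly →ₗ[ℝ] Poly) ∘ₗ (angular i : Poly →ₗ[ℝ] Poly)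

theorem lap_apply (p : Poly) : lap p = ∑ i, angular i (angular i p) := by
  simp [lap]

theorem lap_mem_sphereIdeal {p : Poly} (hp : p ∈ sphereIdeal) : lap p ∈ sphereIdeal := by
  rw [lap_apply]
  exact Ideal.sum_mem _ fun i _ => angular_mem_sphereIdeal i (angular_mem_sphereIdeal i hp)

theorem sphereInt_mul_lap (p q : Poly) :
    sphereInt (p * lap q) = -∑ i, sphereInt (angular i p * angular i q) := by
  simp only [lap_apply, Finset.mul_sum, sphereInt_sum, sphereInt_mul_angular _ p,
    Finset.sum_neg_distrib]

theorem sphereInt_mul_lap_comm (p q : Poly) : sphereInt (p * lap q) = sphereInt (lap p * q) := by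
  rw [mul_comm (lap p), sphereInt_mul_lap, sphereInt_mul_lap]
  simp only [mul_comm]

theorem pderiv_comm (i j : Fin 3) (p : Poly) : pderiv i (pderiv j p) = pderiv j (pderiv i p) := by
  induction p using MvPolynomial.induction_on with
  | C a => simp
  | add p q hp hq => simp [hp, hq]
  | mul_X p k hp =>
    simp only [Derivation.leibniz, pderiv_X, smul_eq_mul, map_add, hp, Pi.single_apply]
    split_ifs <;> simp <;> ring

/-- The Euclidean Laplacian. -/
def flatLap (p : Poly) : Poly := ∑ i, pderiv i (pderiv i p)

/-- The Euler operator. -/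
def euler (p : Poly) : Poly := ∑ i, X i * pderiv i p

theorem lap_eq (p : Poly) :
    lap p = (∑ i, X i ^ 2) * flatLap p - euler (euler p) - euler p := by
  simp only [lap_apply, flatLap, euler, angular_apply, Fin.sum_univ_three, map_add, map_sub,
    Derivation.leibniz, pderiv_X, smul_eq_mul, pderiv_comm 1 0, pderiv_comm 2 0, pderiv_comm 2 1,
    Fin.isValue, zero_add, Fin.reduceAdd, Pi.single_apply]
  simp
  ring

theorem isHomogeneous_angular (i : Fin 3) {p : Poly} {n : ℕ} (hp : p.IsHomogeneous n) :
    (angular i p).IsHomogeneous n := by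
  -- Degree zero is separate because `1 + (n - 1) = n` fails there with truncated subtraction.
  rcases Nat.eq_zero_or_pos n with rfl | hn
  · have h := totalDegree_eq_zero_iff_eq_C.1 ((totalDegree_zero_iff_isHomogeneous _).2 hp)
    rw [h]
    simpa [angular_apply] using isHomogeneous_zero (Fin 3) ℝ 0
  · rw [angular_apply]
    have h (j k : Fin 3) : (X j * pderiv k p : Poly).IsHomogeneous n := by
      have := (isHomogeneous_X ℝ j).mul (hp.pderiv (i := k))
      rwa [show 1 + (n - 1) = n by omega] at this
    exact (h _ _).sub (h _ _)

theorem totalDegree_angular_le (i : Fin 3) (p : Poly) :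
    (angular i p).totalDegree ≤ p.totalDegree := by
  conv_lhs => rw [← sum_homogeneousComponent p, map_sum]
  refine totalDegree_finsetSum_le fun k hk => ?_
  exact (isHomogeneous_angular i (homogeneousComponent_isHomogeneous k p)).totalDegree_le.trans
    (by simpa [Nat.lt_succ_iff] using hk)

theorem totalDegree_lap_le (p : Poly) : (lap p).totalDegree ≤ p.totalDegree := by
  rw [lap_apply]
  exact totalDegree_finsetSum_le fun i _ =>
    (totalDegree_angular_le i _).trans (totalDegree_angular_le i p)

theorem euler_eq {p : Poly} {n : ℕ} (hp : p.IsHomogeneous n) : euler p = (n : ℝ) • p := by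
  rw [euler, hp.sum_X_mul_pderiv, Nat.cast_smul_eq_nsmul]

theorem lap_eq_of_isHomogeneous {p : Poly} {n : ℕ} (hp : p.IsHomogeneous n) :
    lap p = (∑ i, X i ^ 2) * flatLap p - ((n : ℝ) * (n + 1)) • p := by
  have h : euler ((n : ℝ) • p) = (n : ℝ) • euler p := by
    simp [euler, Finset.smul_sum]
  rw [lap_eq, euler_eq hp, h, euler_eq hp]
  module

theorem isHomogeneous_flatLap {p : Poly} {n : ℕ} (hp : p.IsHomogeneous n) :
    (flatLap p).IsHomogeneous (n - 1 - 1) :=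
  IsHomogeneous.sum _ _ _ fun _ _ => hp.pderiv.pderiv

theorem sphere_sum_sq (s : S2) : (s : E3) 0 ^ 2 + (s : E3) 1 ^ 2 + (s : E3) 2 ^ 2 = 1 := by
  have h := EuclideanSpace.norm_sq_eq (s : E3)
  rw [norm_eq_of_mem_sphere s] at h
  simpa [Fin.sum_univ_three] using h.symm

theorem mul_sub_mem_sphereIdeal (q : Poly) : (∑ i, X i ^ 2) * q - q ∈ sphereIdeal := by
  intro s
  have h := sphere_sum_sq s
  simp [Fin.sum_univ_three, h]

/-- On homogeneous polynomials of degree `k` the operator `lap` is `|x|² Δ - k (k + 1)`, and `|x|² =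
1` on the sphere. So `lap + n (n + 1)` lowers the degree modulo the ideal; this drives the
inductions on the degree below. -/
theorem exists_lap_add_smul {p : Poly} {n : ℕ} (hn : 1 ≤ n) (hp : p.totalDegree ≤ n) :
    ∃ q : Poly, q.totalDegree ≤ n - 1 ∧ lap p + ((n : ℝ) * (n + 1)) • p - q ∈ sphereIdeal := by
  have key : ∀ k ≤ n, ∀ f : Poly, f.IsHomogeneous k → ∃ q : Poly, q.totalDegree ≤ n - 1 ∧
      lap f + ((n : ℝ) * (n + 1)) • f - q ∈ sphereIdeal := by
    intro k hk f hf
    refine ⟨flatLap f + ((n : ℝ) * (n + 1) - k * (k + 1)) • f, ?_, ?_⟩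
    · refine (totalDegree_add _ _).trans (max_le ?_ ?_)
      · exact (isHomogeneous_flatLap hf).totalDegree_le.trans (by omega)
      -- In top degree `k = n` the coefficient `n (n + 1) - k (k + 1)` vanishes.
      · rcases hk.eq_or_lt with rfl | hk
        · simp
        · exact (totalDegree_smul_le _ _).trans (hf.totalDegree_le.trans (by omega))
    · rw [lap_eq_of_isHomogeneous hf]
      convert mul_sub_mem_sphereIdeal (flatLap f) using 1
      module
  choose! g hg using fun k (hk : k ≤ n) => key k hk (homogeneousComponent k p)
    (homogeneousComponent_isHomogeneous k p)
  refine ⟨∑ k ∈ Finset.range (p.totalDegree + 1), g k, ?_, ?_⟩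
  · exact totalDegree_finsetSum_le fun k hk => (hg k (by simp at hk; omega)).1
  · conv in lap p + _ => rw [← sum_homogeneousComponent p]
    rw [map_sum, Finset.smul_sum, ← Finset.sum_add_distrib, ← Finset.sum_sub_distrib]
    exact Ideal.sum_mem _ fun k hk => (hg k (by simp at hk; omega)).2

theorem smul_mem_sphereIdeal (c : ℝ) {p : Poly} (hp : p ∈ sphereIdeal) : c • p ∈ sphereIdeal := by
  rw [smul_eq_C_mul]
  exact Ideal.mul_mem_left _ _ hp

/-- If `lap p` vanishes on the sphere, then a nonzero multiple of `p` agrees there with a polynomial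
of lower degree that is again annihilated by `lap`. -/
theorem exists_sub_C_mem_of_lap_mem {p : Poly} (hp : lap p ∈ sphereIdeal) :
    ∃ c : ℝ, p - C c ∈ sphereIdeal := by
  suffices H : ∀ n : ℕ, ∀ p : Poly, p.totalDegree ≤ n → lap p ∈ sphereIdeal →
      ∃ c : ℝ, p - C c ∈ sphereIdeal from H _ p le_rfl hp
  intro n
  induction n with
  | zero =>
    intro p hp _
    refine ⟨coeff 0 p, ?_⟩
    rw [← totalDegree_eq_zero_iff_eq_C.1 (Nat.le_zero.1 hp), sub_self]
    exact Ideal.zero_mem _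
  | succ n ih =>
    intro p hd hp
    obtain ⟨q, hq, hpq⟩ := exists_lap_add_smul (n := n + 1) (by omega) hd
    set N : ℝ := ((n + 1 : ℕ) : ℝ) * (((n + 1 : ℕ) : ℝ) + 1) with hN
    have hN0 : N ≠ 0 := by positivity
    have h1 : N • p - q ∈ sphereIdeal := by
      convert sub_mem hpq hp using 1
      module
    have h2 : lap q ∈ sphereIdeal := by
      have := sub_mem (smul_mem_sphereIdeal N hp) (lap_mem_sphereIdeal h1)
      simpa using this
    obtain ⟨c, hc⟩ := ih q (by simpa using hq) h2
    refine ⟨N⁻¹ * c, ?_⟩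
    convert smul_mem_sphereIdeal N⁻¹ (add_mem h1 hc) using 1
    rw [sub_add_sub_cancel, smul_sub, smul_smul, inv_mul_cancel₀ hN0, one_smul, smul_eq_C_mul,
      C_mul]

theorem area_real_univ : area.real Set.univ = 4 * Real.pi := by
  rw [Measure.toSphere_real_apply_univ, Measure.real, EuclideanSpace.volume_ball_fin_three]
  have h : (0 : ℝ) ≤ Real.pi * 4 / 3 := by positivity
  simp only [ENNReal.ofReal_one, one_pow, one_mul, finrank_euclideanSpace_fin]
  rw [ENNReal.toReal_ofReal h]
  push_cast
  ring

theorem sphereInt_C (c : ℝ) : sphereInt (C c) = 4 * Real.pi * c := by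
  simp only [sphereInt, pev, eval_C, integral_const, area_real_univ, smul_eq_mul]

/-- Write `lap p + N p = q` on the sphere with `q` of lower degree. Then `q` has mean zero with `p`,
and a solution of `lap f = q` gives `lap (f - p) = N p`. -/
theorem exists_lap_eq {q : Poly} (h0 : sphereInt q = 0) : ∃ f : Poly, lap f - q ∈ sphereIdeal := by
  suffices H : ∀ n : ℕ, ∀ q : Poly, q.totalDegree ≤ n → sphereInt q = 0 →
      ∃ f : Poly, lap f - q ∈ sphereIdeal from H _ q le_rfl h0
  intro n
  induction n with
  | zero =>
    intro q hq h0
    rw [totalDegree_eq_zero_iff_eq_C.1 (Nat.le_zero.1 hq)] at h0 ⊢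
    refine ⟨0, ?_⟩
    suffices coeff 0 q = 0 by simp [this]
    have h1 : sphereInt (C (coeff 0 q)) = 4 * Real.pi * coeff 0 q := sphereInt_C _
    rw [h1] at h0
    have := Real.pi_ne_zero
    simpa [this] using h0
  | succ n ih =>
    intro p hd hp
    obtain ⟨q, hq, hpq⟩ := exists_lap_add_smul (n := n + 1) (by omega) hd
    set N : ℝ := ((n + 1 : ℕ) : ℝ) * (((n + 1 : ℕ) : ℝ) + 1) with hN
    have hN0 : N ≠ 0 := by positivity
    have h1 : sphereInt q = 0 := by
      rw [← sphereInt_congr hpq, sphereInt_add, sphereInt_smul, hp, lap_apply, sphereInt_sum]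
      simp [sphereInt_angular]
    obtain ⟨f, hf⟩ := ih q (by simpa using hq) h1
    refine ⟨N⁻¹ • (f - p), ?_⟩
    convert smul_mem_sphereIdeal N⁻¹ (sub_mem hf hpq) using 1
    rw [map_smul, map_sub]
    match_scalars <;> field_simp
    ring

/-! ### Spherical harmonics: orthogonality, dimension, eigenvalues -/

theorem memLp_of_continuous {F : Type*} [NormedAddCommGroup F] [SecondCountableTopology F]
    {f : S2 → F} (hf : Continuous f) : MemLp f 2 area := by
  obtain ⟨C, hC⟩ := isCompact_univ.exists_bound_of_continuousOn hf.continuousOn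
  exact MemLp.of_bound hf.aestronglyMeasurable C
    (Filter.Eventually.of_forall fun s => hC s (Set.mem_univ s))

/-- The restriction of a polynomial to the sphere, as an element of `L²`. -/
def toL2 : Poly →ₗ[ℝ] Lp ℝ 2 area where
  toFun p := (memLp_of_continuous (continuous_pev_sphere p)).toLp _
  map_add' p q := by
    rw [← MemLp.toLp_add]
    congr 1
    ext s
    simp [pev]
  map_smul' c p := by
    rw [RingHom.id_apply, ← MemLp.toLp_const_smul]
    congr 1
    ext s
    simp [pev]

theorem coeFn_toL2 (p : Poly) : toL2 p =ᵐ[area] fun s : S2 => pev p s :=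
  MemLp.coeFn_toLp (memLp_of_continuous (continuous_pev_sphere p))

theorem inner_toL2 (p q : Poly) : inner ℝ (toL2 p) (toL2 q) = sphereInt (p * q) := by
  rw [L2.inner_def]
  refine integral_congr_ae ?_
  filter_upwards [coeFn_toL2 p, coeFn_toL2 q] with s hp hq
  simp [hp, hq, pev, mul_comm]

theorem toL2_eq_zero_iff {p : Poly} : toL2 p = 0 ↔ p ∈ sphereIdeal := by
  rw [← inner_self_eq_zero (𝕜 := ℝ), inner_toL2]
  exact ⟨mem_sphereIdeal_of_sphereInt_mul_self,
    fun h => sphereInt_eq_zero (Ideal.mul_mem_left _ _ h)⟩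

theorem toL2_eq_iff {p q : Poly} : toL2 p = toL2 q ↔ p - q ∈ sphereIdeal := by
  rw [← toL2_eq_zero_iff, map_sub, sub_eq_zero]

/-- The restrictions to the sphere of the polynomials of degree at most `n`. -/
def polySpace (n : ℕ) : Submodule ℝ (Lp ℝ 2 area) := (restrictTotalDegree (Fin 3) ℝ n).map toL2

instance (n : ℕ) : FiniteDimensional ℝ (polySpace n) := by
  unfold polySpace; infer_instance

theorem mem_polySpace {n : ℕ} {f : Lp ℝ 2 area} :
    f ∈ polySpace n ↔ ∃ p : Poly, p.totalDegree ≤ n ∧ toL2 p = f := by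
  simp [polySpace, mem_restrictTotalDegree]

theorem toL2_mem_polySpace {n : ℕ} {p : Poly} (hp : p.totalDegree ≤ n) : toL2 p ∈ polySpace n :=
  mem_polySpace.2 ⟨p, hp, rfl⟩

theorem polySpace_mono {m n : ℕ} (h : m ≤ n) : polySpace m ≤ polySpace n := by
  intro f hf
  obtain ⟨p, hp, rfl⟩ := mem_polySpace.1 hf
  exact toL2_mem_polySpace (hp.trans h)

/-- A family of `(n + 1) ^ 2` monomials which spans the restrictions to the sphere of the
polynomials of degree at most `n`. -/
def spanningMonomial (n : ℕ) (i : Fin (n + 1) × Fin (n + 1)) : Poly :=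
  if (i.1 + i.2 : ℕ) ≤ n then X 0 ^ (i.1 : ℕ) * X 1 ^ (i.2 : ℕ)
  else X 0 ^ (n - i.1 : ℕ) * X 1 ^ (n - i.2 : ℕ) * X 2

/-- The relation `x₂² = 1 - x₀² - x₁²` on the sphere reduces the exponent of `X 2` to `0` or `1`
without raising the degree. -/
theorem toL2_monomial_mem_span (n c : ℕ) : ∀ a b : ℕ, a + b + c ≤ n →
    toL2 (X 0 ^ a * X 1 ^ b * X 2 ^ c) ∈
      Submodule.span ℝ (Set.range fun i => toL2 (spanningMonomial n i)) := by
  induction c using Nat.strong_induction_on with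
  | _ c ih =>
    intro a b h
    match c, ih, h with
    | 0, _, h =>
      refine Submodule.subset_span ⟨(⟨a, by omega⟩, ⟨b, by omega⟩), ?_⟩
      simp only [spanningMonomial]
      rw [if_pos (by omega), pow_zero, mul_one]
    | 1, _, h =>
      -- Index pairs with sum above `n` encode, after the reflection `i ↦ n - i`, the monomials with
      -- one factor `X 2`; so a single square of side `n + 1` indexes both types.
      refine Submodule.subset_span ⟨(⟨n - a, by omega⟩, ⟨n - b, by omega⟩), ?_⟩
      simp only [spanningMonomial]
      rw [if_neg (by omega), pow_one, Nat.sub_sub_self (by omega), Nat.sub_sub_self (by omega)]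
    | c + 2, ih, h =>
      have e : toL2 (X 0 ^ a * X 1 ^ b * X 2 ^ (c + 2)) = toL2 (X 0 ^ a * X 1 ^ b * X 2 ^ c)
          - toL2 (X 0 ^ (a + 2) * X 1 ^ b * X 2 ^ c)
          - toL2 (X 0 ^ a * X 1 ^ (b + 2) * X 2 ^ c) := by
        rw [← map_sub, ← map_sub, toL2_eq_iff]
        convert mul_sub_mem_sphereIdeal (X 0 ^ a * X 1 ^ b * X 2 ^ c) using 1
        rw [Fin.sum_univ_three]
        ring
      rw [e]
      exact sub_mem (sub_mem (ih c (by omega) _ _ (by omega)) (ih c (by omega) _ _ (by omega)))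
        (ih c (by omega) _ _ (by omega))

theorem finrank_polySpace_le (n : ℕ) : finrank ℝ (polySpace n) ≤ (n + 1) ^ 2 := by
  have hle : polySpace n ≤
      Submodule.span ℝ (Set.range fun i => toL2 (spanningMonomial n i)) := by
    intro f hf
    obtain ⟨p, hp, rfl⟩ := mem_polySpace.1 hf
    rw [p.as_sum, map_sum]
    refine Submodule.sum_mem _ fun s hs => ?_
    have hd := (le_totalDegree hs).trans hp
    rw [Finsupp.sum_fintype _ _ (by simp), Fin.sum_univ_three] at hd
    rw [monomial_eq, ← smul_eq_C_mul, map_smul, Finsupp.prod_fintype _ _ (by simp),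
      Fin.prod_univ_three]
    exact Submodule.smul_mem _ _ (toL2_monomial_mem_span n _ _ _ hd)
  have := FiniteDimensional.span_of_finite ℝ
    (Set.finite_range fun i => toL2 (spanningMonomial n i))
  refine (Submodule.finrank_mono hle).trans ((finrank_range_le_card _).trans_eq ?_)
  simp [sq]

/-- The spherical harmonics of degree `n + 1`. -/
def harm (n : ℕ) : Submodule ℝ (Lp ℝ 2 area) := (polySpace n)ᗮ ⊓ polySpace (n + 1)

instance (n : ℕ) : FiniteDimensional ℝ (harm n) :=
  Submodule.finiteDimensional_of_le inf_le_right

/-- The number of independent spherical harmonics of degree `n + 1`. -/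
def harmDim (n : ℕ) : ℕ := finrank ℝ (harm n)

/-- The orthogonal increments `harm n` add up to `polySpace m` without the constants, and `(m + 1)²
- 1 = m (m + 2)`. Only this upper bound on the dimensions is used. -/
theorem sum_harmDim_le (m : ℕ) : ∑ n ∈ Finset.range m, harmDim n ≤ m * (m + 2) := by
  have h : ∀ m, 1 + ∑ n ∈ Finset.range m, harmDim n ≤ finrank ℝ (polySpace m) := by
    intro m
    induction m with
    | zero =>
      have : Nontrivial (polySpace 0) := by
        refine ⟨⟨⟨toL2 1, toL2_mem_polySpace (by simp)⟩, 0, ?_⟩⟩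
        intro h
        have h1 : toL2 1 = 0 := congrArg Subtype.val h
        obtain ⟨s⟩ : Nonempty S2 := (NormedSpace.sphere_nonempty.2 zero_le_one).to_subtype
        have h2 := toL2_eq_zero_iff.1 h1 s
        simp at h2
      simpa using Nat.one_le_iff_ne_zero.2 (finrank_pos (R := ℝ) (M := polySpace 0)).ne'
    | succ m ih =>
      rw [Finset.sum_range_succ, ← Submodule.finrank_add_inf_finrank_orthogonal
        (polySpace_mono m.le_succ)]
      have : harmDim m = finrank ℝ ↥((polySpace m)ᗮ ⊓ polySpace (m + 1)) := rfl
      simp only [Nat.succ_eq_add_one]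
      omega
  have h1 := (h m).trans (finrank_polySpace_le m)
  nlinarith

/-- An orthonormal basis of the spherical harmonics of degree `n + 1`. -/
def harmBasis (n : ℕ) : OrthonormalBasis (Fin (harmDim n)) ℝ (harm n) :=
  stdOrthonormalBasis ℝ (harm n)

theorem exists_poly_harm (n : ℕ) (k : Fin (harmDim n)) :
    ∃ p : Poly, p.totalDegree ≤ n + 1 ∧ toL2 p = (harmBasis n k : Lp ℝ 2 area) :=
  mem_polySpace.1 (inf_le_right (a := (polySpace n)ᗮ) (harmBasis n k).2)

/-- Polynomials representing an orthonormal basis of the spherical harmonics of degree `n + 1`. -/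
def harmPoly (n : ℕ) (k : Fin (harmDim n)) : Poly := (exists_poly_harm n k).choose

theorem totalDegree_harmPoly_le (n : ℕ) (k : Fin (harmDim n)) :
    (harmPoly n k).totalDegree ≤ n + 1 := (exists_poly_harm n k).choose_spec.1

theorem toL2_harmPoly (n : ℕ) (k : Fin (harmDim n)) :
    toL2 (harmPoly n k) = (harmBasis n k : Lp ℝ 2 area) :=
  (exists_poly_harm n k).choose_spec.2

theorem toL2_harmPoly_mem (n : ℕ) (k : Fin (harmDim n)) : toL2 (harmPoly n k) ∈ harm n := by
  rw [toL2_harmPoly]; exact (harmBasis n k).2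

theorem mem_harm_iff {n : ℕ} {p : Poly} (hp : p.totalDegree ≤ n + 1) :
    toL2 p ∈ harm n ↔ ∀ q : Poly, q.totalDegree ≤ n → sphereInt (p * q) = 0 := by
  constructor
  · intro h q hq
    rw [← inner_toL2, real_inner_comm]
    exact h.1 _ (toL2_mem_polySpace hq)
  · intro h
    refine ⟨fun f hf => ?_, toL2_mem_polySpace hp⟩
    obtain ⟨q, hq, rfl⟩ := mem_polySpace.1 hf
    rw [real_inner_comm, inner_toL2, h q hq]

theorem sphereInt_harmPoly_mul_eq_zero {n : ℕ} (k : Fin (harmDim n)) {q : Poly}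
    (hq : q.totalDegree ≤ n) : sphereInt (harmPoly n k * q) = 0 :=
  (mem_harm_iff (totalDegree_harmPoly_le n k)).1 (toL2_harmPoly_mem n k) q hq

theorem sphereInt_harmPoly_mul_same (n : ℕ) (k l : Fin (harmDim n)) :
    sphereInt (harmPoly n k * harmPoly n l) = if k = l then 1 else 0 := by
  rw [← inner_toL2, toL2_harmPoly, toL2_harmPoly, ← Submodule.coe_inner]
  exact orthonormal_iff_ite.1 (harmBasis n).orthonormal k l

theorem sphereInt_harmPoly_mul_of_ne {n m : ℕ} (h : n ≠ m) (k : Fin (harmDim n))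
    (l : Fin (harmDim m)) : sphereInt (harmPoly n k * harmPoly m l) = 0 := by
  rcases h.lt_or_gt with h | h
  · rw [mul_comm]
    exact sphereInt_harmPoly_mul_eq_zero l ((totalDegree_harmPoly_le n k).trans h)
  · exact sphereInt_harmPoly_mul_eq_zero k ((totalDegree_harmPoly_le m l).trans h)

/-- The eigenvalue of the (negative) Laplacian on the spherical harmonics of degree `n + 1`. -/
def eig (n : ℕ) : ℝ := ((n : ℝ) + 1) * (n + 2)

theorem eig_pos (n : ℕ) : 0 < eig n := by unfold eig; positivity

/-- The remainder `q = lap p + λ p` has degree at most `n`, and so has `lap q`. As `p` is orthogonal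
to both, `∫ q² = ∫ p (lap q) + λ ∫ p q = 0`. -/
theorem lap_harmPoly (n : ℕ) (k : Fin (harmDim n)) :
    lap (harmPoly n k) + eig n • harmPoly n k ∈ sphereIdeal := by
  obtain ⟨q, hq, h⟩ := exists_lap_add_smul (Nat.le_add_left 1 n) (totalDegree_harmPoly_le n k)
  have he : ((n + 1 : ℕ) : ℝ) * ((n + 1 : ℕ) + 1) = eig n := by
    unfold eig; push_cast; ring
  rw [he] at h
  replace hq : q.totalDegree ≤ n := by simpa using hq
  have hqq : q ∈ sphereIdeal := by
    refine mem_sphereIdeal_of_sphereInt_mul_self ?_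
    have h1 : (lap (harmPoly n k) + eig n • harmPoly n k) * q - q * q ∈ sphereIdeal := by
      rw [← sub_mul]; exact Ideal.mul_mem_right _ _ h
    rw [← sphereInt_congr h1, add_mul, sphereInt_add, ← sphereInt_mul_lap_comm, smul_mul_assoc,
      sphereInt_smul, sphereInt_harmPoly_mul_eq_zero k hq,
      sphereInt_harmPoly_mul_eq_zero k ((totalDegree_lap_le q).trans hq)]
    simp
  simpa using add_mem h hqq

theorem sub_sum_mem_of_toL2_mem_harm {n : ℕ} {p : Poly} (hp : toL2 p ∈ harm n) :
    p - ∑ k, sphereInt (p * harmPoly n k) • harmPoly n k ∈ sphereIdeal := by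
  rw [← toL2_eq_iff, map_sum]
  have h := (harmBasis n).sum_repr' ⟨toL2 p, hp⟩
  have h' := congrArg Subtype.val h
  simp only [AddSubmonoidClass.coe_finsetSum, Submodule.coe_smul, Submodule.coe_inner,
    ← toL2_harmPoly] at h'
  rw [← h']
  refine Finset.sum_congr rfl fun k _ => ?_
  rw [map_smul, inner_toL2, mul_comm]

theorem exists_harmPoly_expansion (D : ℕ) : ∀ p : Poly, p.totalDegree ≤ D →
    ∃ (c : ℝ) (a : (n : ℕ) → Fin (harmDim n) → ℝ),
      p - C c - ∑ n ∈ Finset.range D, ∑ k, a n k • harmPoly n k ∈ sphereIdeal := by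
  induction D with
  | zero =>
    intro p hp
    refine ⟨coeff 0 p, 0, ?_⟩
    rw [← totalDegree_eq_zero_iff_eq_C.1 (Nat.le_zero.1 hp)]
    simp
  | succ D ih =>
    intro p hp
    -- The projection of `p` to degree at most `D` is handled by induction; what remains lies in
    -- `harm D`.
    obtain ⟨q, hq, hqp⟩ := mem_polySpace.1
      ((polySpace D).starProjection_apply_mem (toL2 p))
    have hh : toL2 (p - q) ∈ harm D := by
      rw [map_sub]
      refine ⟨?_, sub_mem (toL2_mem_polySpace hp) (toL2_mem_polySpace (hq.trans D.le_succ))⟩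
      rw [hqp]
      exact Submodule.sub_starProjection_mem_orthogonal _
    obtain ⟨c, a, ha⟩ := ih q hq
    refine ⟨c, fun n k => if n = D then sphereInt ((p - q) * harmPoly n k) else a n k, ?_⟩
    convert add_mem ha (sub_sum_mem_of_toL2_mem_harm hh) using 1
    rw [Finset.sum_range_succ]
    have e : ∑ n ∈ Finset.range D, ∑ k, (if n = D then sphereInt ((p - q) * harmPoly n k)
        else a n k) • harmPoly n k = ∑ n ∈ Finset.range D, ∑ k, a n k • harmPoly n k := by
      refine Finset.sum_congr rfl fun n hn => ?_
      simp [(Finset.mem_range.1 hn).ne]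
    rw [e]
    simp only [if_true]
    abel

/-! ### Addition formulas -/

/-- Each `L i` preserves `harm n` and acts there by an antisymmetric matrix `A`. So `∑ p_k L p_k = ∑
A k l p_k p_l = 0`, and the sum of squares is annihilated by every `L i`, hence constant. Its
integral is the dimension, which gives the value of the constant. -/
theorem sum_sq_harmPoly (n : ℕ) :
    ∑ k, harmPoly n k * harmPoly n k - C (harmDim n / (4 * Real.pi)) ∈ sphereIdeal := by
  set K : Poly := ∑ k, harmPoly n k * harmPoly n k with hK
  have hang (i : Fin 3) : angular i K ∈ sphereIdeal := by
    set A : Fin (harmDim n) → Fin (harmDim n) → ℝ := fun k l =>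
      sphereInt (angular i (harmPoly n k) * harmPoly n l) with hA
    have hanti (k l) : A k l = -A l k := by
      have := sphereInt_mul_angular i (harmPoly n k) (harmPoly n l)
      simp only [hA]
      rw [mul_comm (angular i (harmPoly n l)), this, neg_neg]
    have hexp (k) : angular i (harmPoly n k) - ∑ l, A k l • harmPoly n l ∈ sphereIdeal := by
      refine sub_sum_mem_of_toL2_mem_harm ?_
      rw [mem_harm_iff ((totalDegree_angular_le i _).trans (totalDegree_harmPoly_le n k))]
      intro q hq
      have := sphereInt_mul_angular i (harmPoly n k) q
      rw [sphereInt_harmPoly_mul_eq_zero k ((totalDegree_angular_le i q).trans hq)] at this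
      linarith
    have hzero : ∑ k, harmPoly n k * ∑ l, A k l • harmPoly n l = 0 := by
      have h1 : ∑ k, harmPoly n k * ∑ l, A k l • harmPoly n l =
          -∑ k, harmPoly n k * ∑ l, A k l • harmPoly n l := by
        conv_lhs => simp only [Finset.mul_sum]
        rw [Finset.sum_comm]
        simp only [Finset.mul_sum, ← Finset.sum_neg_distrib]
        refine Finset.sum_congr rfl fun k _ => Finset.sum_congr rfl fun l _ => ?_
        rw [hanti l k, neg_smul, mul_neg, mul_smul_comm, mul_smul_comm, mul_comm]
      exact self_eq_neg.1 h1
    have h2 : ∑ k, harmPoly n k * (angular i (harmPoly n k) - ∑ l, A k l • harmPoly n l) ∈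
        sphereIdeal := Ideal.sum_mem _ fun k _ => Ideal.mul_mem_left _ _ (hexp k)
    simp only [mul_sub, Finset.sum_sub_distrib, hzero, sub_zero] at h2
    rw [hK, map_sum]
    simp only [Derivation.leibniz, smul_eq_mul, Finset.sum_add_distrib]
    exact add_mem h2 h2
  obtain ⟨c, hc⟩ := exists_sub_C_mem_of_lap_mem (p := K) (by
    rw [lap_apply]
    exact Ideal.sum_mem _ fun i _ => angular_mem_sphereIdeal i (hang i))
  have hint : sphereInt K = harmDim n := by
    rw [hK, sphereInt_sum]
    simp [sphereInt_harmPoly_mul_same]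
  rw [sphereInt_congr hc, sphereInt_C] at hint
  have hp := Real.pi_ne_zero
  rw [← hint, mul_div_cancel_left₀ _ (by positivity)]
  exact hc

/-- Apply `lap (p²) = 2 p lap p + 2 |L p|²` to the constant sum of squares: the left side vanishes,
and the eigenvalue equation evaluates `p lap p`. -/
theorem sum_angular_sq_harmPoly (n : ℕ) :
    ∑ k, ∑ i, angular i (harmPoly n k) * angular i (harmPoly n k)
      - C (eig n * (harmDim n / (4 * Real.pi))) ∈ sphereIdeal := by
  have hl (p : Poly) : lap (p * p) =
      (2 : ℝ) • (p * lap p) + (2 : ℝ) • ∑ i, angular i p * angular i p := by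
    simp only [lap_apply, Derivation.leibniz, smul_eq_mul, map_add,
      Fin.sum_univ_three, smul_eq_C_mul, map_ofNat]
    ring
  have h0 := lap_mem_sphereIdeal (sum_sq_harmPoly n)
  have hC (c : ℝ) : lap (C c) = 0 := by
    simp [lap_apply]
  rw [map_sub, hC, sub_zero, map_sum] at h0
  simp only [hl, ← smul_add, ← Finset.smul_sum, Finset.sum_add_distrib] at h0
  have h1 : ∑ k, harmPoly n k * (lap (harmPoly n k) + eig n • harmPoly n k) ∈ sphereIdeal :=
    Ideal.sum_mem _ fun k _ => Ideal.mul_mem_left _ _ (lap_harmPoly n k)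
  simp only [mul_add, mul_smul_comm, Finset.sum_add_distrib, ← Finset.smul_sum] at h1
  convert add_mem (sub_mem (smul_mem_sphereIdeal (1 / 2) h0) h1)
    (smul_mem_sphereIdeal (eig n) (sum_sq_harmPoly n)) using 1
  rw [C_mul, ← smul_eq_C_mul]
  module

/-! ### Polynomial tangent fields and their Hodge decomposition -/

/-- The field `x × ∇ p`. -/
def curlField : Poly →ₗ[ℝ] (Fin 3 → Poly) := LinearMap.pi fun i => (angular i : Poly →ₗ[ℝ] Poly)

theorem curlField_apply (p : Poly) (i : Fin 3) : curlField p i = angular i p := rfl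

/-- The field `x × Z`. -/
def crossX (Z : Fin 3 → Poly) : Fin 3 → Poly :=
  fun i => X (i + 1) * Z (i + 2) - X (i + 2) * Z (i + 1)

/-- The field `- x × (x × ∇ p)`, which on the sphere is the surface gradient of `p`. -/
def gradField : Poly →ₗ[ℝ] (Fin 3 → Poly) where
  toFun p := -crossX (curlField p)
  map_add' p q := by
    ext1 i; simp only [crossX, map_add, Pi.add_apply, Pi.neg_apply]; ring
  map_smul' c p := by
    ext1 i
    simp only [crossX, map_smul, Pi.smul_apply, Pi.neg_apply, RingHom.id_apply, mul_smul_comm]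
    module

theorem gradField_apply (p : Poly) (i : Fin 3) :
    gradField p i = X (i + 2) * angular (i + 1) p - X (i + 1) * angular (i + 2) p := by
  simp [gradField, crossX, curlField_apply]

/-- The surface rotation of a tangent field. -/
def rotPoly (Z : Fin 3 → Poly) : Poly := ∑ i, angular i (Z i)

/-- The surface divergence of a tangent field. -/
def divPoly (Z : Fin 3 → Poly) : Poly := ∑ i, angular i (crossX Z i)

/-- The normal component of a field. -/
def normalPoly (Z : Fin 3 → Poly) : Poly := ∑ i, X i * Z i

/-- The pointwise inner product of two fields. -/
def dotPoly (Z W : Fin 3 → Poly) : Poly := ∑ i, Z i * W i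

theorem sphereInt_dot_curlField (Z : Fin 3 → Poly) (p : Poly) :
    sphereInt (dotPoly Z (curlField p)) = -sphereInt (rotPoly Z * p) := by
  simp only [dotPoly, rotPoly, curlField_apply, Finset.sum_mul, sphereInt_sum,
    sphereInt_mul_angular, Finset.sum_neg_distrib]

theorem sphereInt_dot_gradField (Z : Fin 3 → Poly) (p : Poly) :
    sphereInt (dotPoly Z (gradField p)) = -sphereInt (divPoly Z * p) := by
  have h : dotPoly Z (gradField p) = dotPoly (crossX Z) (curlField p) := by
    simp only [dotPoly, gradField_apply, curlField_apply, crossX, Fin.sum_univ_three]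
    simp
    ring
  rw [h, sphereInt_dot_curlField]
  rfl

theorem normalPoly_curlField (p : Poly) : normalPoly (curlField p) = 0 := by
  simp only [normalPoly, curlField_apply, angular_apply, Fin.sum_univ_three]
  simp
  ring

theorem normalPoly_gradField (p : Poly) : normalPoly (gradField p) = 0 := by
  simp only [normalPoly, gradField_apply, Fin.sum_univ_three]
  simp
  ring

theorem rotPoly_curlField (p : Poly) : rotPoly (curlField p) = lap p := by
  simp [rotPoly, curlField_apply, lap_apply]

/-- The surface divergence in terms of partial derivatives. -/
theorem divPoly_eq (Z : Fin 3 → Poly) : divPoly Z =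
    (∑ i, X i ^ 2) * ∑ i, pderiv i (Z i) - normalPoly Z - euler (normalPoly Z) := by
  simp only [divPoly, normalPoly, euler, crossX, angular_apply, Fin.sum_univ_three, map_add,
    map_sub, Derivation.leibniz, pderiv_X, smul_eq_mul, Pi.single_apply]
  simp
  ring

theorem divPoly_curlField (p : Poly) : divPoly (curlField p) = 0 := by
  rw [divPoly_eq, normalPoly_curlField]
  have : ∑ i, pderiv i (curlField p i) = 0 := by
    simp only [curlField_apply, angular_apply, Fin.sum_univ_three, map_sub, Derivation.leibniz,
      pderiv_X, smul_eq_mul, Pi.single_apply, pderiv_comm 1 0, pderiv_comm 2 0, pderiv_comm 2 1,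
      zero_add, Fin.reduceAdd]
    simp
  simp [this, euler]

theorem rotPoly_gradField (p : Poly) : rotPoly (gradField p) = 0 := by
  have : rotPoly (gradField p) = -divPoly (curlField p) := by
    simp [rotPoly, divPoly, gradField]
  rw [this, divPoly_curlField, neg_zero]

/-- Since `x · (x × ∇ p) = 0`, crossing twice with `x` only multiplies `x × ∇ p` by `-|x|²`, and
angular derivatives do not see `|x|²`. -/
theorem divPoly_gradField (p : Poly) : divPoly (gradField p) = (∑ i, X i ^ 2) * lap p := by
  have h (i : Fin 3) : crossX (gradField p) i = (∑ i, X i ^ 2) * angular i p := by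
    have h0 := normalPoly_curlField p
    simp only [normalPoly, curlField_apply, Fin.sum_univ_three] at h0
    fin_cases i <;> simp [crossX, gradField_apply, Fin.sum_univ_three]
    · linear_combination (-X 0 : Poly) * h0
    · linear_combination (-X 1 : Poly) * h0
    · linear_combination (-X 2 : Poly) * h0
  have h1 (i : Fin 3) : angular i (∑ j, X j ^ 2) = 0 := by
    simp only [angular_apply, Fin.sum_univ_three, map_add, Derivation.leibniz_pow, pderiv_X,
      Pi.single_apply]
    fin_cases i <;> simp <;> ring
  simp only [divPoly, h, Derivation.leibniz, h1, smul_eq_mul, mul_zero, add_zero, lap_apply,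
    Finset.mul_sum]

theorem angular_commutator (i : Fin 3) (p : Poly) :
    angular i (angular (i + 1) p) - angular (i + 1) (angular i p) = -angular (i + 2) p := by
  simp only [angular_apply, map_sub, Derivation.leibniz, pderiv_X, smul_eq_mul, Pi.single_apply]
  fin_cases i <;>
  · simp [pderiv_comm 1 0, pderiv_comm 2 0, pderiv_comm 2 1]
    ring

/-- The field `L × Z` for the angular derivative `L`. -/
def angularCurl (Z : Fin 3 → Poly) (i : Fin 3) : Poly :=
  angular (i + 1) (Z (i + 2)) - angular (i + 2) (Z (i + 1))

/-- This is `(x × ∇) × Z = ∇ (x · Z) - Z - x (∇ · Z)`. Its use is that `L × Z = -Z` on the sphere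
when `Z` is tangent and free of divergence. -/
theorem angularCurl_eq (Z : Fin 3 → Poly) (i : Fin 3) : angularCurl Z i =
    pderiv i (normalPoly Z) - Z i - X i * ∑ j, pderiv j (Z j) := by
  simp only [angularCurl, normalPoly, angular_apply, Fin.sum_univ_three, map_add,
    Derivation.leibniz, pderiv_X, smul_eq_mul, Pi.single_apply]
  fin_cases i <;>
  · simp
    ring

theorem sum_angular_sq_eq (Z : Fin 3 → Poly) :
    ∑ i, ∑ k, angular k (Z i) * angular k (Z i) =
      dotPoly (angularCurl Z) (angularCurl Z) + ∑ i, ∑ k, angular k (Z i) * angular i (Z k) := by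
  simp only [dotPoly, angularCurl, Fin.sum_univ_three]
  simp
  ring

/-- Two integrations by parts exchange the derivatives `L k` and `L i`; the commutators `[L i, L (i
+ 1)] = -L (i + 2)` leave the term `Z · (L × Z)`. -/
theorem sphereInt_sum_angular_mul (Z : Fin 3 → Poly) :
    sphereInt (∑ i, ∑ k, angular k (Z i) * angular i (Z k)) =
      sphereInt (rotPoly Z * rotPoly Z) + sphereInt (dotPoly Z (angularCurl Z)) := by
  have h1 : sphereInt (∑ i, ∑ k, angular k (Z i) * angular i (Z k)) =
      -sphereInt (∑ i, ∑ k, Z i * angular k (angular i (Z k))) := by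
    simp only [sphereInt_sum, sphereInt_mul_angular, Finset.sum_neg_distrib, neg_neg]
  have h2 : sphereInt (rotPoly Z * rotPoly Z) =
      -sphereInt (∑ i, ∑ k, Z i * angular i (angular k (Z k))) := by
    simp only [rotPoly, Finset.sum_mul_sum, sphereInt_sum, ← Finset.sum_neg_distrib]
    refine Finset.sum_congr rfl fun i _ => Finset.sum_congr rfl fun k _ => ?_
    rw [sphereInt_mul_angular i (Z i) (angular k (Z k)), neg_neg]
  have h3 : ∑ i, ∑ k, Z i * angular k (angular i (Z k)) =
      ∑ i, ∑ k, Z i * angular i (angular k (Z k)) - dotPoly Z (angularCurl Z) := by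
    have c (i : Fin 3) (p) := angular_commutator i p
    simp only [dotPoly, angularCurl, Fin.sum_univ_three]
    have c0 := c 0
    have c1 := c 1
    have c2 := c 2
    simp at c0 c1 c2 ⊢
    linear_combination Z 0 * c2 (Z 2) - Z 0 * c0 (Z 1) + Z 1 * c0 (Z 0) - Z 1 * c1 (Z 2)
      + Z 2 * c1 (Z 1) - Z 2 * c2 (Z 0)
  rw [h1, h2, h3, sphereInt_sub]
  ring

/-- A tangent field on the sphere without divergence and rotation vanishes. -/
theorem mem_sphereIdeal_of_div_rot {Z : Fin 3 → Poly} (hZ : normalPoly Z = 0)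
    (hd : divPoly Z ∈ sphereIdeal) (hr : rotPoly Z ∈ sphereIdeal) (i : Fin 3) :
    Z i ∈ sphereIdeal := by
  set d : Poly := ∑ i, pderiv i (Z i) with hd_def
  have hd' : d ∈ sphereIdeal := by
    have h := sub_mem hd (mul_sub_mem_sphereIdeal d)
    rw [divPoly_eq, hZ] at h
    simpa [euler, ← hd_def] using h
  have hc (i : Fin 3) : angularCurl Z i + Z i ∈ sphereIdeal := by
    rw [angularCurl_eq, hZ, ← hd_def]
    convert neg_mem (Ideal.mul_mem_left _ (X i) hd') using 1
    simp only [map_zero]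
    ring
  -- All angular derivatives of `Z` together have square integral `∫ (rot Z)² + ∫ (L × Z + Z) · (L ×
  -- Z)`, which is zero. Then `L × Z` vanishes on the sphere, and so does `Z = -L × Z`.
  have h0 : sphereInt (∑ i, ∑ k, angular k (Z i) * angular k (Z i)) = 0 := by
    rw [sum_angular_sq_eq, sphereInt_add, sphereInt_sum_angular_mul,
      sphereInt_eq_zero (Ideal.mul_mem_left _ _ hr), zero_add, ← sphereInt_add]
    refine sphereInt_eq_zero ?_
    rw [dotPoly, dotPoly, ← Finset.sum_add_distrib]
    refine Ideal.sum_mem _ fun i _ => ?_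
    rw [← add_mul]
    exact Ideal.mul_mem_right _ _ (hc i)
  have h1 (i k : Fin 3) : angular k (Z i) ∈ sphereIdeal := by
    refine mem_sphereIdeal_of_sphereInt_mul_self ?_
    simp only [sphereInt_sum] at h0
    have h2 := (Finset.sum_eq_zero_iff_of_nonneg fun i _ =>
      Finset.sum_nonneg fun k _ => sphereInt_mul_self_nonneg _).1 h0 i (Finset.mem_univ i)
    exact (Finset.sum_eq_zero_iff_of_nonneg fun k _ =>
      sphereInt_mul_self_nonneg _).1 h2 k (Finset.mem_univ k)
  have h3 := sub_mem (hc i) (sub_mem (h1 (i + 2) (i + 1)) (h1 (i + 1) (i + 2)))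
  simpa [angularCurl] using h3

theorem normalPoly_sub (Z W : Fin 3 → Poly) :
    normalPoly (Z - W) = normalPoly Z - normalPoly W := by
  simp [normalPoly, mul_sub]

theorem rotPoly_sub (Z W : Fin 3 → Poly) : rotPoly (Z - W) = rotPoly Z - rotPoly W := by
  simp [rotPoly]

theorem divPoly_sub (Z W : Fin 3 → Poly) : divPoly (Z - W) = divPoly Z - divPoly W := by
  simp only [divPoly, crossX, Pi.sub_apply, ← Finset.sum_sub_distrib, ← map_sub]
  refine Finset.sum_congr rfl fun i _ => ?_
  congr 1
  ring

/-- Hodge decomposition of polynomial tangent fields on the sphere. -/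
theorem exists_potentials {Z : Fin 3 → Poly} (hZ : normalPoly Z = 0) :
    ∃ f g : Poly, ∀ i, Z i - gradField f i - curlField g i ∈ sphereIdeal := by
  obtain ⟨f, hf⟩ := exists_lap_eq (q := divPoly Z) (by
    simp [divPoly, sphereInt_sum, sphereInt_angular])
  obtain ⟨g, hg⟩ := exists_lap_eq (q := rotPoly Z) (by
    simp [rotPoly, sphereInt_sum, sphereInt_angular])
  -- Subtracting the gradient with the divergence of `Z` and the rotated gradient with its rotation
  -- leaves a field with neither.
  refine ⟨f, g, mem_sphereIdeal_of_div_rot (Z := Z - gradField f - curlField g) ?_ ?_ ?_⟩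
  · rw [normalPoly_sub, normalPoly_sub, hZ, normalPoly_gradField, normalPoly_curlField]
    simp
  · rw [divPoly_sub, divPoly_sub, divPoly_gradField, divPoly_curlField, sub_zero]
    convert neg_mem (add_mem hf (mul_sub_mem_sphereIdeal (lap f))) using 1
    ring
  · rw [rotPoly_sub, rotPoly_sub, rotPoly_gradField, rotPoly_curlField, sub_zero]
    convert neg_mem hg using 1
    ring

/-- The two kinds of vector fields with potential `p`: the gradient for `true`, the
rotated gradient for `false`. -/
def potField (b : Bool) : Poly →ₗ[ℝ] (Fin 3 → Poly) := if b then gradField else curlField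

theorem potField_C (b : Bool) (c : ℝ) : potField b (C c) = 0 := by
  have h (i : Fin 3) : angular i (C c) = 0 := by simp
  cases b <;> ext1 i <;> simp [potField, curlField_apply, gradField_apply, h]

theorem potField_mem_sphereIdeal (b : Bool) {p : Poly} (hp : p ∈ sphereIdeal) (i : Fin 3) :
    potField b p i ∈ sphereIdeal := by
  cases b
  · exact angular_mem_sphereIdeal i hp
  · simp only [potField, if_true, gradField_apply]
    exact sub_mem (Ideal.mul_mem_left _ _ (angular_mem_sphereIdeal _ hp))
      (Ideal.mul_mem_left _ _ (angular_mem_sphereIdeal _ hp))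

theorem dotPoly_potField_self_sub_mem (b : Bool) (p : Poly) :
    dotPoly (potField b p) (potField b p) - ∑ i, angular i p * angular i p ∈ sphereIdeal := by
  cases b
  · simp [dotPoly, potField, curlField_apply]
  · convert mul_sub_mem_sphereIdeal (∑ i, angular i p * angular i p) using 2
    have h := normalPoly_curlField p
    simp only [normalPoly, curlField_apply, Fin.sum_univ_three] at h
    simp only [dotPoly, potField, if_true, gradField_apply, Fin.sum_univ_three]
    simp
    linear_combination (-(X 0 * angular 0 p + X 1 * angular 1 p + X 2 * angular 2 p)) * h

theorem sphereInt_dotPoly_potField (b : Bool) (p q : Poly) :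
    sphereInt (dotPoly (potField b p) (potField b q)) = -sphereInt (lap p * q) := by
  cases b
  · simp only [potField, Bool.false_eq_true, if_false]
    rw [sphereInt_dot_curlField, rotPoly_curlField]
  · simp only [potField, if_true]
    rw [sphereInt_dot_gradField, divPoly_gradField, mul_assoc,
      sphereInt_congr (mul_sub_mem_sphereIdeal (lap p * q))]

theorem dotPoly_comm (Z W : Fin 3 → Poly) : dotPoly Z W = dotPoly W Z := by
  simp [dotPoly, mul_comm]

theorem sphereInt_dotPoly_potField_of_ne {b b' : Bool} (h : b ≠ b') (p q : Poly) :
    sphereInt (dotPoly (potField b p) (potField b' q)) = 0 := by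
  have key (p q) : sphereInt (dotPoly (gradField p) (curlField q)) = 0 := by
    rw [sphereInt_dot_curlField, rotPoly_gradField, zero_mul, sphereInt_eq_zero (zero_mem _),
      neg_zero]
  cases b <;> cases b'
  · exact absurd rfl h
  · rw [dotPoly_comm]; exact key q p
  · exact key p q
  · exact absurd rfl h

/-! ### Vector spherical harmonics -/

/-- The vector spherical harmonics of degree `n + 1`, normalized in `L²`. -/
def vecHarm (b : Bool) (n : ℕ) (k : Fin (harmDim n)) : Fin 3 → Poly :=
  (√(eig n))⁻¹ • potField b (harmPoly n k)

theorem dotPoly_smul_smul (c d : ℝ) (Z W : Fin 3 → Poly) :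
    dotPoly (c • Z) (d • W) = (c * d) • dotPoly Z W := by
  simp [dotPoly, Finset.smul_sum, smul_smul, mul_comm]

theorem sphereInt_vecHarm_self (b : Bool) (n : ℕ) (k l : Fin (harmDim n)) :
    sphereInt (dotPoly (vecHarm b n k) (vecHarm b n l)) = if k = l then 1 else 0 := by
  have h0 : sphereInt (lap (harmPoly n k) * harmPoly n l) =
      -(eig n * if k = l then 1 else 0) := by
    rw [sphereInt_congr (q := (-eig n) • (harmPoly n k * harmPoly n l)), sphereInt_smul,
      sphereInt_harmPoly_mul_same, neg_mul]
    convert Ideal.mul_mem_right (harmPoly n l) _ (lap_harmPoly n k) using 1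
    rw [add_mul, neg_smul, sub_neg_eq_add, smul_mul_assoc]
  have he := eig_pos n
  rw [vecHarm, vecHarm, dotPoly_smul_smul, sphereInt_smul, sphereInt_dotPoly_potField, h0, neg_neg,
    ← mul_assoc, ← mul_inv, Real.mul_self_sqrt he.le, inv_mul_cancel₀ he.ne', one_mul]

theorem sphereInt_vecHarm_of_ne {b b' : Bool} {n m : ℕ} (h : b ≠ b' ∨ n ≠ m)
    (k : Fin (harmDim n)) (l : Fin (harmDim m)) :
    sphereInt (dotPoly (vecHarm b n k) (vecHarm b' m l)) = 0 := by
  rw [vecHarm, vecHarm, dotPoly_smul_smul, sphereInt_smul]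
  by_cases hb : b = b'
  · subst hb
    have hn : n ≠ m := h.resolve_left (by simp)
    rw [sphereInt_dotPoly_potField,
      sphereInt_congr (q := (-eig n) • (harmPoly n k * harmPoly m l)), sphereInt_smul,
      sphereInt_harmPoly_mul_of_ne hn]
    · simp
    · convert Ideal.mul_mem_right (harmPoly m l) _ (lap_harmPoly n k) using 1
      rw [add_mul, neg_smul, sub_neg_eq_add, smul_mul_assoc]
  · rw [sphereInt_dotPoly_potField_of_ne hb, mul_zero]

theorem sum_dotPoly_vecHarm (b : Bool) (n : ℕ) :
    ∑ k, dotPoly (vecHarm b n k) (vecHarm b n k) - C (harmDim n / (4 * Real.pi)) ∈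
      sphereIdeal := by
  have he := eig_pos n
  have h1 : ∑ k, (dotPoly (potField b (harmPoly n k)) (potField b (harmPoly n k)) -
      ∑ i, angular i (harmPoly n k) * angular i (harmPoly n k)) ∈ sphereIdeal :=
    Ideal.sum_mem _ fun k _ => dotPoly_potField_self_sub_mem b _
  have h2 := smul_mem_sphereIdeal (eig n)⁻¹ (add_mem h1 (sum_angular_sq_harmPoly n))
  convert h2 using 1
  simp only [vecHarm, dotPoly_smul_smul, ← mul_inv, Real.mul_self_sqrt he.le,
    Finset.sum_sub_distrib, ← Finset.smul_sum]
  rw [C_mul, ← smul_eq_C_mul, sub_add_sub_cancel, smul_sub, smul_smul,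
    inv_mul_cancel₀ he.ne', one_smul]

/-- Polynomial tangent fields are combinations of finitely many vector spherical harmonics. -/
theorem exists_vecHarm_expansion {Z : Fin 3 → Poly} (hZ : normalPoly Z = 0) :
    ∃ (D : ℕ) (a : Bool → (n : ℕ) → Fin (harmDim n) → ℝ), ∀ i,
      Z i - ∑ b, ∑ n ∈ Finset.range D, ∑ k, a b n k • vecHarm b n k i ∈ sphereIdeal := by
  obtain ⟨f, g, hfg⟩ := exists_potentials hZ
  set D := max f.totalDegree g.totalDegree
  have hex (b : Bool) (p : Poly) (hp : p.totalDegree ≤ D) :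
      ∃ a : (n : ℕ) → Fin (harmDim n) → ℝ, ∀ i, potField b p i
        - ∑ n ∈ Finset.range D, ∑ k, a n k • vecHarm b n k i ∈ sphereIdeal := by
    obtain ⟨c, a, ha⟩ := exists_harmPoly_expansion D p hp
    refine ⟨fun n k => a n k * √(eig n), fun i => ?_⟩
    convert potField_mem_sphereIdeal b ha i using 1
    simp only [map_sub, map_sum, potField_C, map_smul, Pi.sub_apply, Finset.sum_apply,
      Pi.smul_apply, sub_zero]
    congr 1
    refine Finset.sum_congr rfl fun n _ => Finset.sum_congr rfl fun k _ => ?_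
    have he := eig_pos n
    rw [vecHarm, Pi.smul_apply, smul_smul, mul_assoc, mul_inv_cancel₀ (by positivity), mul_one]
  obtain ⟨a, ha⟩ := hex true f (le_max_left _ _)
  obtain ⟨a', ha'⟩ := hex false g (le_max_right _ _)
  refine ⟨D, fun b => if b then a else a', fun i => ?_⟩
  convert add_mem (add_mem (hfg i) (ha i)) (ha' i) using 1
  simp [potField]
  abel

/-! ### Completeness in the square integrable tangent fields -/

/-- The values of a polynomial vector field on the sphere. -/
def fieldEval (Z : Fin 3 → Poly) (s : S2) : E3 := WithLp.toLp 2 fun i => pev (Z i) s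

theorem fieldEval_apply (Z : Fin 3 → Poly) (s : S2) (i : Fin 3) :
    fieldEval Z s i = pev (Z i) s := rfl

theorem continuous_fieldEval (Z : Fin 3 → Poly) : Continuous (fieldEval Z) :=
  (PiLp.continuous_toLp 2 _).comp (continuous_pi fun i => continuous_pev_sphere (Z i))

theorem inner_fieldEval (Z W : Fin 3 → Poly) (s : S2) :
    inner ℝ (fieldEval Z s) (fieldEval W s) = pev (dotPoly Z W) s := by
  simp [PiLp.inner_apply, dotPoly, fieldEval_apply, mul_comm]

theorem norm_sq_fieldEval (Z : Fin 3 → Poly) (s : S2) :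
    ‖fieldEval Z s‖ ^ 2 = pev (dotPoly Z Z) s := by
  rw [← inner_fieldEval, real_inner_self_eq_norm_sq]

theorem fieldEval_congr {Z W : Fin 3 → Poly} (h : ∀ i, Z i - W i ∈ sphereIdeal) :
    fieldEval Z = fieldEval W := by
  ext s i
  have := h i s
  simpa [sub_eq_zero, fieldEval_apply] using this

/-- The restriction of a polynomial vector field to the sphere, as an element of `L²`. -/
def vecL2 : (Fin 3 → Poly) →ₗ[ℝ] Lp E3 2 area where
  toFun Z := (memLp_of_continuous (continuous_fieldEval Z)).toLp _
  map_add' Z W := by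
    rw [← MemLp.toLp_add]
    congr 1
    ext s i
    simp [fieldEval_apply]
  map_smul' c Z := by
    rw [RingHom.id_apply, ← MemLp.toLp_const_smul]
    congr 1
    ext s i
    simp [fieldEval_apply]

theorem coeFn_vecL2 (Z : Fin 3 → Poly) : vecL2 Z =ᵐ[area] fieldEval Z :=
  MemLp.coeFn_toLp (memLp_of_continuous (continuous_fieldEval Z))

theorem inner_vecL2 (Z W : Fin 3 → Poly) :
    inner ℝ (vecL2 Z) (vecL2 W) = sphereInt (dotPoly Z W) := by
  rw [L2.inner_def]
  refine integral_congr_ae ?_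
  filter_upwards [coeFn_vecL2 Z, coeFn_vecL2 W] with s hZ hW
  rw [hZ, hW, inner_fieldEval]

theorem inner_vecL2_toLp (Z : Fin 3 → Poly) {u : S2 → E3} (hu : MemLp u 2 area) :
    inner ℝ (vecL2 Z) (hu.toLp u) = ∫ s, inner ℝ (fieldEval Z s) (u s) ∂area := by
  rw [L2.inner_def]
  refine integral_congr_ae ?_
  filter_upwards [coeFn_vecL2 Z, hu.coeFn_toLp] with s hZ hu
  rw [hZ, hu]

theorem vecL2_congr {Z W : Fin 3 → Poly} (h : ∀ i, Z i - W i ∈ sphereIdeal) :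
    vecL2 Z = vecL2 W := by
  have := fieldEval_congr h
  simp only [vecL2, LinearMap.coe_mk, AddHom.coe_mk, this]

/-- The algebra of polynomial functions on the sphere. -/
def polyAlg : Poly →ₐ[ℝ] C(S2, ℝ) :=
  MvPolynomial.aeval fun i => ⟨fun s : S2 => (s : E3) i, by fun_prop⟩

theorem polyAlg_apply (p : Poly) (s : S2) : polyAlg p s = pev p s := by
  induction p using MvPolynomial.induction_on with
  | C a => simp [polyAlg]
  | add p q hp hq => simp [hp, hq]
  | mul_X p i hp => simp [hp]; left; simp [polyAlg]

theorem exists_poly_approx (g : C(S2, ℝ)) {ε : ℝ} (hε : 0 < ε) :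
    ∃ p : Poly, ∀ s : S2, |g s - pev p s| < ε := by
  have hsep : polyAlg.range.SeparatesPoints := by
    intro x y hxy
    have : ∃ i, (x : E3) i ≠ (y : E3) i := by
      by_contra! h
      exact hxy (Subtype.ext (by ext i; exact h i))
    obtain ⟨i, hi⟩ := this
    refine ⟨_, ⟨polyAlg (X i), ⟨X i, rfl⟩, rfl⟩, ?_⟩
    simpa [polyAlg_apply] using hi
  obtain ⟨⟨f, p, rfl⟩, hf⟩ :=
    ContinuousMap.exists_mem_subalgebra_near_continuousMap_of_separatesPoints polyAlg.range hsep g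
      ε hε
  refine ⟨p, fun s => ?_⟩
  have := (ContinuousMap.norm_lt_iff _ hε).1 hf s
  rw [abs_sub_comm]
  simpa [polyAlg_apply] using this

theorem denseRange_vecL2 : DenseRange vecL2 := by
  set T : (Fin 3 → Poly) → C(S2, E3) := fun Z => ⟨fieldEval Z, continuous_fieldEval Z⟩
  have hT : DenseRange T := by
    refine Metric.denseRange_iff.2 fun g ε hε => ?_
    -- An error below `ε / 2` in each of three components suffices, because `3 (ε / 2)² < ε²`.
    have h (i : Fin 3) := exists_poly_approx
      ⟨fun s => g s i, by fun_prop⟩ (show (0 : ℝ) < ε / 2 by positivity)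
    choose Z hZ using h
    refine ⟨Z, (ContinuousMap.dist_lt_iff hε).2 fun s => ?_⟩
    rw [dist_eq_norm, ← sq_lt_sq₀ (norm_nonneg _) hε.le, EuclideanSpace.norm_sq_eq,
      Fin.sum_univ_three]
    have h (i : Fin 3) : ‖(g s - T Z s) i‖ ^ 2 < (ε / 2) ^ 2 :=
      pow_lt_pow_left₀ (hZ i s) (abs_nonneg _) two_ne_zero
    have := h 0
    have := h 1
    have := h 2
    nlinarith
  have hd := ContinuousMap.toLp_denseRange (p := 2) E3 area ℝ (by simp)
  exact hd.comp hT (ContinuousMap.toLp 2 area ℝ).continuous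

/-- The tangential part of a polynomial vector field. -/
def tangentPart (W : Fin 3 → Poly) : Fin 3 → Poly :=
  fun i => (∑ j, X j ^ 2) * W i - normalPoly W * X i

/-- The factor `|x|²` in `tangentPart` makes the normal component vanish identically, not only on
the sphere. The Hodge decomposition needs this, since it differentiates `x · Z` in all directions.
-/
theorem normalPoly_tangentPart (W : Fin 3 → Poly) : normalPoly (tangentPart W) = 0 := by
  simp only [tangentPart, normalPoly, Fin.sum_univ_three]
  ring

theorem fieldEval_tangentPart (W : Fin 3 → Poly) (s : S2) :
    fieldEval (tangentPart W) s =
      fieldEval W s - (inner ℝ (fieldEval W s) (s : E3)) • (s : E3) := by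
  have h := sphere_sum_sq s
  ext i
  simp [fieldEval_apply, tangentPart, normalPoly, Fin.sum_univ_three, h, PiLp.inner_apply]

theorem norm_sub_inner_smul_le (s : S2) (v : E3) : ‖v - inner ℝ v (s : E3) • (s : E3)‖ ≤ ‖v‖ := by
  have hs : ‖(s : E3)‖ = 1 := norm_eq_of_mem_sphere s
  rw [← sq_le_sq₀ (norm_nonneg _) (norm_nonneg _), norm_sub_sq_real, norm_smul, hs,
    real_inner_smul_right, Real.norm_eq_abs, mul_one, sq_abs]
  nlinarith [sq_nonneg (inner ℝ v (s : E3))]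

/-- The tangential projection fixes `u` and is a pointwise contraction, so projecting an
approximating polynomial field does not increase the error. -/
theorem exists_tangent_poly_near {u : S2 → E3} (hu : MemLp u 2 area)
    (ht : ∀ᵐ s ∂area, inner ℝ (u s) (s : E3) = 0) {ε : ℝ} (hε : 0 < ε) :
    ∃ Z : Fin 3 → Poly, normalPoly Z = 0 ∧ ‖hu.toLp u - vecL2 Z‖ < ε := by
  obtain ⟨W, hW⟩ := Metric.denseRange_iff.1 denseRange_vecL2 (hu.toLp u) ε hε
  refine ⟨tangentPart W, normalPoly_tangentPart W, ?_⟩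
  rw [dist_eq_norm] at hW
  refine lt_of_le_of_lt (Lp.norm_le_norm_of_ae_le ?_) hW
  filter_upwards [Lp.coeFn_sub (hu.toLp u) (vecL2 W),
    Lp.coeFn_sub (hu.toLp u) (vecL2 (tangentPart W)), hu.coeFn_toLp, coeFn_vecL2 W,
    coeFn_vecL2 (tangentPart W), ht] with s h1 h2 h3 h4 h5 h6
  rw [h1, h2, Pi.sub_apply, Pi.sub_apply, h3, h4, h5, fieldEval_tangentPart]
  have h7 := norm_sub_inner_smul_le s (u s - fieldEval W s)
  rw [inner_sub_left, h6, zero_sub, neg_smul, sub_neg_eq_add] at h7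
  rwa [sub_sub_eq_add_sub, add_sub_right_comm]

/-- The index set of the scalar spherical harmonics. -/
abbrev HarmIdx : Type := Σ n : ℕ, Fin (harmDim n)

/-- The scalar spherical harmonics in `L²`. -/
def harmL2 (α : HarmIdx) : Lp ℝ 2 area := toL2 (harmPoly α.1 α.2)

theorem orthonormal_harmL2 : Orthonormal ℝ harmL2 := by
  rw [orthonormal_iff_ite]
  rintro ⟨n, k⟩ ⟨m, l⟩
  rw [harmL2, harmL2, inner_toL2]
  by_cases h : n = m
  · subst h
    simp [sphereInt_harmPoly_mul_same]
  · rw [sphereInt_harmPoly_mul_of_ne h, if_neg]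
    simp [h]

/-- The vector spherical harmonics in `L²`. -/
def vecHarmL2 (α : Bool × HarmIdx) : Lp E3 2 area := vecL2 (vecHarm α.1 α.2.1 α.2.2)

theorem orthonormal_vecHarmL2 : Orthonormal ℝ vecHarmL2 := by
  rw [orthonormal_iff_ite]
  rintro ⟨b, n, k⟩ ⟨b', m, l⟩
  rw [vecHarmL2, vecHarmL2, inner_vecL2]
  by_cases h : b ≠ b' ∨ n ≠ m
  · rw [sphereInt_vecHarm_of_ne h, if_neg]
    intro he
    simp only [Prod.mk.injEq, Sigma.mk.injEq] at he
    rcases h with h | h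
    · exact h he.1
    · exact h he.2.1
  · push Not at h
    obtain ⟨rfl, rfl⟩ := h
    simp [sphereInt_vecHarm_self]

/-- The scalar spherical harmonics of degree at most `D`. -/
def harmFinset (D : ℕ) : Finset HarmIdx := (Finset.range D).sigma fun _ => Finset.univ

theorem sum_harmFinset {M : Type*} [AddCommMonoid M] (D : ℕ) (f : HarmIdx → M) :
    ∑ α ∈ harmFinset D, f α = ∑ n ∈ Finset.range D, ∑ k, f ⟨n, k⟩ :=
  Finset.sum_sigma _ _ _

/-- A best approximation property of partial sums of orthonormal expansions. -/
theorem norm_sub_sum_inner_le {H ι : Type*} [NormedAddCommGroup H] [InnerProductSpace ℝ H]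
    {e : ι → H} (he : Orthonormal ℝ e) (t : Finset ι) (x : H) (a : ι → ℝ) :
    ‖x - ∑ i ∈ t, inner ℝ (e i) x • e i‖ ≤ ‖x - ∑ i ∈ t, a i • e i‖ := by
  classical
  set P := ∑ i ∈ t, inner ℝ (e i) x • e i with hP
  set Q := ∑ i ∈ t, a i • e i with hQ
  have h0 : inner ℝ (x - P) (P - Q) = 0 := by
    rw [hQ, hP, ← Finset.sum_sub_distrib, inner_sum]
    refine Finset.sum_eq_zero fun i hi => ?_
    rw [← sub_smul, inner_smul_right, inner_sub_left, he.inner_left_sum _ hi, real_inner_comm]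
    simp
  have h1 := norm_add_sq_real (x - P) (P - Q)
  rw [h0, sub_add_sub_cancel] at h1
  rw [← sq_le_sq₀ (norm_nonneg _) (norm_nonneg _), h1]
  nlinarith [sq_nonneg ‖P - Q‖]

/-- The partial sums of the expansion of a tangent field in vector spherical harmonics converge. -/
theorem tendsto_vecHarm_expansion {u : S2 → E3} (hu : MemLp u 2 area)
    (ht : ∀ᵐ s ∂area, inner ℝ (u s) (s : E3) = 0) :
    Tendsto (fun D => ∑ α ∈ Finset.univ ×ˢ harmFinset D,
      inner ℝ (vecHarmL2 α) (hu.toLp u) • vecHarmL2 α) atTop (𝓝 (hu.toLp u)) := by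
  rw [Metric.tendsto_atTop]
  intro ε hε
  obtain ⟨Z, hZ, hlt⟩ := exists_tangent_poly_near hu ht hε
  obtain ⟨D, a, ha⟩ := exists_vecHarm_expansion hZ
  refine ⟨D, fun D' hD => ?_⟩
  rw [dist_comm, dist_eq_norm]
  -- `Z` is itself a combination of harmonics of degree at most `D'`, padded with zero coefficients,
  -- so the orthogonal partial sum of `u` is at least as close.
  have hexp : vecL2 Z = ∑ α ∈ Finset.univ ×ˢ harmFinset D',
      (if α.2.1 < D then a α.1 α.2.1 α.2.2 else 0) • vecHarmL2 α := by
    have h1 : vecL2 Z =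
        ∑ b, ∑ n ∈ Finset.range D, ∑ k, a b n k • vecL2 (vecHarm b n k) := by
      simp only [← map_smul, ← map_sum]
      refine vecL2_congr fun i => ?_
      simpa [Finset.sum_apply] using ha i
    rw [h1, Finset.sum_product]
    refine Finset.sum_congr rfl fun b _ => ?_
    rw [sum_harmFinset, ← Finset.sum_subset (Finset.range_mono hD)]
    · refine Finset.sum_congr rfl fun n hn => Finset.sum_congr rfl fun k _ => ?_
      rw [if_pos (Finset.mem_range.1 hn)]
      rfl
    · intro n _ hn
      refine Finset.sum_eq_zero fun k _ => ?_
      rw [if_neg (by simpa using hn), zero_smul]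
  refine lt_of_le_of_lt ?_ hlt
  rw [hexp]
  exact norm_sub_sum_inner_le orthonormal_vecHarmL2 _ _ _

/-- The pointwise bound for the vector spherical harmonics of degree at most `m`. -/
theorem sum_norm_sq_vecHarm_le (B : Finset Bool) (m : ℕ) (s : S2) :
    ∑ α ∈ B ×ˢ harmFinset m, ‖fieldEval (vecHarm α.1 α.2.1 α.2.2) s‖ ^ 2 ≤
      B.card / (4 * Real.pi) * (m * (m + 2)) := by
  have h (b : Bool) (n : ℕ) : ∑ k, ‖fieldEval (vecHarm b n k) s‖ ^ 2 =
      harmDim n / (4 * Real.pi) := by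
    have := sum_dotPoly_vecHarm b n s
    simp only [norm_sq_fieldEval]
    simpa [sub_eq_zero, pev] using this
  have hd : ∑ n ∈ Finset.range m, (harmDim n : ℝ) ≤ m * (m + 2) := by
    exact_mod_cast sum_harmDim_le m
  simp only [Finset.sum_product, sum_harmFinset, h, ← Finset.sum_div]
  rw [Finset.sum_const, nsmul_eq_mul, div_mul_eq_mul_div]
  gcongr

/-! ### Weak divergence and rotation tested against polynomials -/

theorem cross_coord (v w : E3) (i : Fin 3) :
    cross v w i = v (i + 1) * w (i + 2) - v (i + 2) * w (i + 1) := by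
  fin_cases i <;> simp [cross, cross_apply]

theorem tangentProj_apply (s v : E3) : tangentProj s v = v - inner ℝ s v • s := by
  simp [tangentProj]

theorem inner_self_sphere (s : S2) : inner ℝ (s : E3) (s : E3) = 1 := by
  rw [real_inner_self_eq_norm_sq, norm_eq_of_mem_sphere s, one_pow]

theorem tangentProj_of_inner_eq_zero {s v : E3} (h : inner ℝ s v = 0) : tangentProj s v = v := by
  simp [tangentProj_apply, h]

theorem tangentProj_self (s : S2) : tangentProj s (s : E3) = 0 := by
  rw [tangentProj_apply, inner_self_sphere, one_smul, sub_self]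

theorem inner_tangentProj (s : S2) (v : E3) : inner ℝ (s : E3) (tangentProj s v) = 0 := by
  rw [tangentProj_apply, inner_sub_right, inner_smul_right, inner_self_sphere, mul_one, sub_self]

theorem trace_tangentProj (s : S2) :
    LinearMap.trace ℝ E3 (tangentProj s : E3 →ₗ[ℝ] E3) = 2 := by
  have h : (tangentProj s : E3 →ₗ[ℝ] E3) =
      LinearMap.id - (innerSL ℝ (s : E3) : E3 →ₗ[ℝ] ℝ).smulRight (s : E3) := rfl
  rw [h, map_sub, LinearMap.trace_smulRight, LinearMap.trace_id]
  have := inner_self_sphere s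
  simp
  norm_num

/-- The standard basis of `E3`. -/
abbrev stdE (i : Fin 3) : E3 := EuclideanSpace.single i (1 : ℝ)

/-- The tangential part of the `i`-th standard basis vector. -/
def frame (i : Fin 3) (x : E3) : E3 := stdE i - x i • x

theorem inner_frame (i : Fin 3) (s : S2) : inner ℝ (frame i s) (s : E3) = 0 := by
  rw [frame, inner_sub_left, real_inner_smul_left, inner_self_sphere]
  simp [EuclideanSpace.inner_single_left]

theorem hasFDerivAt_frame (i : Fin 3) (x : E3) :
    HasFDerivAt (frame i)
      (-(x i • ContinuousLinearMap.id ℝ E3 + (coord i).smulRight x)) x := by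
  have h := ((coord i).hasFDerivAt (x := x)).smul (hasFDerivAt_id x)
  exact (h.const_sub (stdE i))

theorem contDiff_frame (i : Fin 3) : ContDiff ℝ ∞ (frame i) :=
  contDiff_const.sub ((coord i).contDiff.smul contDiff_id)

/-- The frame field multiplied by a polynomial. -/
def frameMul (p : Poly) (i : Fin 3) (x : E3) : E3 := pev p x • frame i x

theorem isSmoothTangent_frame (i : Fin 3) : IsSmoothTangent (frame i) :=
  ⟨contDiff_frame i, inner_frame i⟩

theorem isSmoothTangent_frameMul (p : Poly) (i : Fin 3) : IsSmoothTangent (frameMul p i) :=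
  ⟨(contDiff_pev p).smul (contDiff_frame i), fun s => by
    rw [frameMul, real_inner_smul_left, inner_frame, mul_zero]⟩

theorem covDeriv_frame (i : Fin 3) (s : S2) :
    covDeriv (frame i) s = (-(s : E3) i) • tangentProj s := by
  ext1 v
  simp only [covDeriv, ContinuousLinearMap.comp_apply, (hasFDerivAt_frame i (s : E3)).fderiv]
  simp only [neg_apply, add_apply,
    smul_apply, ContinuousLinearMap.id_apply,
    ContinuousLinearMap.smulRight_apply, map_neg, map_add, map_smul, tangentProj_self, smul_zero,
    add_zero, tangentProj_of_inner_eq_zero (inner_tangentProj s v), neg_smul]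

theorem smoothDiv_frame (i : Fin 3) (s : S2) : smoothDiv (frame i) s = -2 * (s : E3) i := by
  rw [smoothDiv, covDeriv_frame, ContinuousLinearMap.toLinearMap_smul, map_smul, trace_tangentProj,
    smul_eq_mul]
  ring

theorem covDeriv_frameMul (p : Poly) (i : Fin 3) (s : S2) :
    covDeriv (frameMul p i) s (frame i s) =
      ((∑ j, pev (pderiv j p) s * frame i s j) - pev p s * (s : E3) i) • frame i s := by
  have ht : inner ℝ (s : E3) (frame i s) = 0 := by rw [real_inner_comm]; exact inner_frame i s
  have hf : HasFDerivAt (frameMul p i) _ (s : E3) :=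
    (hasFDerivAt_pev p s).smul (hasFDerivAt_frame i (s : E3))
  simp only [covDeriv, ContinuousLinearMap.comp_apply, hf.fderiv,
    tangentProj_of_inner_eq_zero ht]
  simp only [neg_apply, add_apply,
    smul_apply, ContinuousLinearMap.id_apply,
    ContinuousLinearMap.smulRight_apply, map_neg, map_add, map_smul, tangentProj_self, smul_zero,
    add_zero, tangentProj_of_inner_eq_zero ht, sum_apply]
  rw [sub_smul, smul_neg, smul_smul, add_comm, ← sub_eq_add_neg]
  simp

theorem memLp_coord {u : S2 → E3} (hu : MemLp u 2 area) (i : Fin 3) :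
    MemLp (fun s => u s i) 2 area := (coord i).comp_memLp' hu

theorem integrable_mul_pev {f : S2 → ℝ} (hf : MemLp f 2 area) (p : Poly) :
    Integrable (fun s : S2 => f s * pev p s) area :=
  hf.integrable_mul (memLp_of_continuous (continuous_pev_sphere p))

theorem trace_eq_sum_coord (A : E3 →L[ℝ] E3) :
    LinearMap.trace ℝ E3 (A : E3 →ₗ[ℝ] E3) = ∑ i, A (stdE i) i := by
  rw [LinearMap.trace_eq_sum_inner _ (EuclideanSpace.basisFun (Fin 3) ℝ)]
  simp [EuclideanSpace.inner_single_left]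

theorem memLp_entry {A : S2 → E3 →L[ℝ] E3} (hA : MemLp A 2 area) (i j : Fin 3) :
    MemLp (fun s => A s (stdE i) j) 2 area :=
  ((coord j).comp (ContinuousLinearMap.apply ℝ E3 (stdE i))).comp_memLp' hA

theorem memLp_trace {A : S2 → E3 →L[ℝ] E3} (hA : MemLp A 2 area) :
    MemLp (fun s => LinearMap.trace ℝ E3 (A s : E3 →ₗ[ℝ] E3)) 2 area := by
  simp only [trace_eq_sum_coord]
  exact memLp_finsetSum _ fun i _ => memLp_entry hA i i

theorem coord_stdE (i j : Fin 3) : stdE i j = if j = i then 1 else 0 := by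
  simp

/-- Testing with `X = frame i` and `Y = p • frame i` isolates the diagonal entry `A i i`, and
summing over `i` gives the trace. The identity holds for every weak covariant derivative, so the
choice made in `weakCovDeriv` is harmless and no uniqueness is needed. -/
theorem integral_trace_mul {u : S2 → E3} {A : S2 → E3 →L[ℝ] E3} (hu : MemLp u 2 area)
    (ht : ∀ᵐ s ∂area, inner ℝ (u s) (s : E3) = 0) (hA : IsWeakCovDeriv u A) (p : Poly) :
    ∫ s, LinearMap.trace ℝ E3 (A s : E3 →ₗ[ℝ] E3) * pev p s ∂area =
      -∫ s, inner ℝ (fieldEval (gradField p) s) (u s) ∂area := by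
  -- The coefficient `3` combines `1` from the derivative of the frame and `2` from its divergence.
  -- This term drops out of the sum over `i` because `u` is tangent.
  set q : Fin 3 → Poly := fun i =>
    pderiv i p - (∑ j, X i * X j * pderiv j p) - 3 * (X i * p) with hq
  have hi (i : Fin 3) : ∫ s, A s (stdE i) i * pev p s ∂area =
      -∫ s, u s i * pev (q i) s ∂area := by
    have h := hA.integral_eq _ _ (isSmoothTangent_frame i) (isSmoothTangent_frameMul p i)
    have h1 : ∫ s, A s (stdE i) i * pev p s ∂area =
        ∫ s : S2, inner ℝ (A s (frame i s)) (frameMul p i s) ∂area := by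
      refine integral_congr_ae ?_
      filter_upwards [hA.map_normal, hA.map_tangent] with s h1 h2
      rw [frameMul, real_inner_smul_right, frame, map_sub, map_smul, h1, smul_zero, sub_zero,
        inner_sub_right, real_inner_smul_right, h2, EuclideanSpace.inner_single_right]
      simp [mul_comm]
    rw [h1, h]
    congr 1
    refine integral_congr_ae ?_
    filter_upwards [ht] with s hs
    rw [covDeriv_frameMul, smoothDiv_frame, frameMul, smul_smul, ← add_smul,
      real_inner_smul_right]
    have h2 : inner ℝ (u s) (frame i s) = u s i := by
      rw [frame, inner_sub_right, real_inner_smul_right, hs, EuclideanSpace.inner_single_right]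
      simp
    rw [h2, mul_comm]
    congr 1
    simp only [hq, frame, PiLp.sub_apply, coord_stdE, PiLp.smul_apply, smul_eq_mul, pev, map_sub,
      map_mul, map_sum, eval_X, map_ofNat]
    fin_cases i <;> simp [Fin.sum_univ_three] <;> ring
  simp only [trace_eq_sum_coord, Finset.sum_mul]
  rw [integral_finsetSum _ fun i _ => integrable_mul_pev (memLp_entry hA.memLp i i) p]
  simp only [hi, Finset.sum_neg_distrib]
  rw [← integral_finsetSum _ fun i _ => integrable_mul_pev (memLp_coord hu i) (q i)]
  congr 1
  refine integral_congr_ae ?_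
  filter_upwards [ht] with s hs
  have h1 := sphere_sum_sq s
  simp only [PiLp.inner_apply, Fin.sum_univ_three, RCLike.inner_apply, conj_trivial] at hs
  simp [hq, Fin.sum_univ_three, PiLp.inner_apply, fieldEval_apply, gradField_apply, angular_apply]
  linear_combination (-3 * pev p s) * hs -
    (u s 0 * pev (pderiv 0 p) s + u s 1 * pev (pderiv 1 p) s + u s 2 * pev (pderiv 2 p) s) * h1

/-- The cross product as a continuous bilinear map. -/
def crossL : E3 →L[ℝ] E3 →L[ℝ] E3 :=
  LinearMap.toContinuousLinearMap (LinearMap.toContinuousLinearMap.toLinearMap ∘ₗ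
    LinearMap.mk₂ ℝ cross
      (fun a b c => by ext i; simp only [cross_coord, PiLp.add_apply]; ring)
      (fun a b c => by ext i; simp only [cross_coord, PiLp.smul_apply, smul_eq_mul]; ring)
      (fun a b c => by ext i; simp only [cross_coord, PiLp.add_apply]; ring)
      (fun a b c => by ext i; simp only [cross_coord, PiLp.smul_apply, smul_eq_mul]; ring))

theorem crossL_apply (v w : E3) : crossL v w = cross v w := rfl

theorem inner_cross_left (v w z : E3) : inner ℝ (cross v w) z = -inner ℝ w (cross v z) := by
  simp [PiLp.inner_apply, Fin.sum_univ_three, cross_coord]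
  ring

theorem inner_cross_self (v w : E3) : inner ℝ (cross v w) v = 0 := by
  simp [PiLp.inner_apply, Fin.sum_univ_three, cross_coord]
  ring

theorem tangentProj_cross_self (s : S2) (v : E3) :
    tangentProj s (cross s v) = cross s (tangentProj s v) := by
  have h : inner ℝ (s : E3) (cross s v) = 0 := by rw [real_inner_comm, inner_cross_self]
  rw [tangentProj_of_inner_eq_zero h]
  ext i
  simp only [cross_coord, tangentProj_apply, PiLp.sub_apply, PiLp.smul_apply, smul_eq_mul]
  ring

theorem tangentProj_cross_tangent (s : S2) {v w : E3} (hv : inner ℝ (s : E3) v = 0)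
    (hw : inner ℝ (s : E3) w = 0) : tangentProj s (cross v w) = 0 := by
  have h := sphere_sum_sq s
  simp only [PiLp.inner_apply, Fin.sum_univ_three, RCLike.inner_apply, conj_trivial] at hv hw
  rw [tangentProj_apply, sub_eq_zero]
  ext i
  simp only [PiLp.inner_apply, Fin.sum_univ_three, RCLike.inner_apply, conj_trivial,
    PiLp.smul_apply, smul_eq_mul, cross_coord]
  fin_cases i <;> simp
  · linear_combination (-(v 1 * w 2 - v 2 * w 1)) * h + (s : E3) 2 * (v 1 * hw - w 1 * hv)
      - (s : E3) 1 * (v 2 * hw - w 2 * hv)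
  · linear_combination (-(v 2 * w 0 - v 0 * w 2)) * h + (s : E3) 0 * (v 2 * hw - w 2 * hv)
      - (s : E3) 2 * (v 0 * hw - w 0 * hv)
  · linear_combination (-(v 0 * w 1 - v 1 * w 0)) * h + (s : E3) 1 * (v 0 * hw - w 0 * hv)
      - (s : E3) 0 * (v 1 * hw - w 1 * hv)

theorem isSmoothTangent_cross {Y : E3 → E3} (hY : IsSmoothTangent Y) :
    IsSmoothTangent fun x => cross x (Y x) :=
  ⟨(crossL.contDiff.clm_apply hY.smooth), fun _ => inner_cross_self _ _⟩

/-- In the product rule for `x × Y` the extra term `v × Y` is normal when `v` and `Y` are tangent,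
so the projection removes it: the quarter turn is parallel. -/
theorem covDeriv_cross {Y : E3 → E3} (hY : IsSmoothTangent Y) (s : S2) (v : E3) :
    covDeriv (fun x => cross x (Y x)) s v = cross s (covDeriv Y s v) := by
  have hd : HasFDerivAt Y (fderiv ℝ Y s) (s : E3) :=
    (hY.smooth.differentiable (by simp)).differentiableAt.hasFDerivAt
  have hc : HasFDerivAt (fun x => cross x (Y x)) _ (s : E3) :=
    (crossL.hasFDerivAt (x := (s : E3))).clm_apply hd
  simp only [covDeriv, ContinuousLinearMap.comp_apply, hc.fderiv]
  simp only [add_apply, ContinuousLinearMap.comp_apply,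
    ContinuousLinearMap.flip_apply, crossL_apply, map_add]
  rw [tangentProj_cross_self, tangentProj_cross_tangent s (inner_tangentProj s v)
    (by rw [real_inner_comm]; exact hY.tangent s), add_zero]

theorem aestronglyMeasurable_crossL_comp {Ω : Type*} [MeasurableSpace Ω] {μ : Measure Ω}
    {f : Ω → E3} {A : Ω → E3 →L[ℝ] E3} (hf : AEStronglyMeasurable f μ)
    (hA : AEStronglyMeasurable A μ) :
    AEStronglyMeasurable (fun s => (crossL (f s)).comp (A s)) μ := by
  exact ((ContinuousLinearMap.compL ℝ E3 E3 E3).comp crossL).aestronglyMeasurable_comp₂ hf hA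

theorem memLp_crossL_comp {A : S2 → E3 →L[ℝ] E3} (hA : MemLp A 2 area) :
    MemLp (fun s : S2 => (crossL s).comp (A s)) 2 area := by
  refine MemLp.of_le_mul (c := ‖crossL‖) hA ?_ (Eventually.of_forall fun s => ?_)
  · exact aestronglyMeasurable_crossL_comp
      (by fun_prop : Continuous fun s : S2 => (s : E3)).aestronglyMeasurable hA.aestronglyMeasurable
  · refine (ContinuousLinearMap.opNorm_comp_le _ _).trans ?_
    gcongr
    simpa using crossL.le_opNorm (s : E3)

theorem memLp_cross {u : S2 → E3} (hu : MemLp u 2 area) :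
    MemLp (fun s : S2 => cross s (u s)) 2 area := by
  refine MemLp.of_le_mul (c := ‖crossL‖) hu ?_ (Eventually.of_forall fun s => ?_)
  · have h : Continuous fun z : E3 × E3 => cross z.1 z.2 :=
      (crossL.continuous.comp continuous_fst).clm_apply continuous_snd
    have hm : AEStronglyMeasurable (fun s : S2 => ((s : E3), u s)) area :=
      (by fun_prop : Continuous fun s : S2 => (s : E3)).aestronglyMeasurable.prodMk
        hu.aestronglyMeasurable
    exact h.comp_aestronglyMeasurable hm
  · refine ((crossL (s : E3)).le_opNorm _).trans ?_
    gcongr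
    simpa using crossL.le_opNorm (s : E3)

/-- The quarter turn is skew and commutes with the covariant derivative, so it can be moved onto the
test field `Y`. -/
theorem isWeakCovDeriv_cross {u : S2 → E3} {A : S2 → E3 →L[ℝ] E3} (hA : IsWeakCovDeriv u A) :
    IsWeakCovDeriv (fun s => cross s (u s)) fun s => (crossL s).comp (A s) where
  memLp := memLp_crossL_comp hA.memLp
  map_normal := by
    filter_upwards [hA.map_normal] with s hs
    simp [hs]
  map_tangent := Eventually.of_forall fun s v => by
    simp [crossL_apply, inner_cross_self]
  integral_eq X Y hX hY := by
    have h := hA.integral_eq X _ hX (isSmoothTangent_cross hY)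
    simp only [ContinuousLinearMap.comp_apply, crossL_apply, inner_cross_left, integral_neg]
    rw [h]
    congr 2
    refine integral_congr_ae (Eventually.of_forall fun s => ?_)
    simp only [covDeriv_cross hY]
    simp only [← crossL_apply, ← map_smul, ← map_add]

theorem weakCovDeriv_spec {u : S2 → E3} (h : ∃ A, IsWeakCovDeriv u A) :
    IsWeakCovDeriv u (weakCovDeriv u) := by
  rw [weakCovDeriv, dif_pos h]
  exact h.choose_spec

theorem MemH1.cross {u : S2 → E3} (hu : MemH1 u) : MemH1 fun s => cross s (u s) where
  memLp := memLp_cross hu.memLp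
  tangent := Eventually.of_forall fun _ => inner_cross_self _ _
  exists_weakCovDeriv := hu.exists_weakCovDeriv.imp' _ fun _ h => isWeakCovDeriv_cross h

theorem MemH1.memLp_div {u : S2 → E3} (hu : MemH1 u) : MemLp (div u) 2 area :=
  memLp_trace (weakCovDeriv_spec hu.exists_weakCovDeriv).memLp

theorem MemH1.integral_div_mul {u : S2 → E3} (hu : MemH1 u) (p : Poly) :
    ∫ s, div u s * pev p s ∂area = -∫ s, inner ℝ (fieldEval (gradField p) s) (u s) ∂area :=
  integral_trace_mul hu.memLp hu.tangent (weakCovDeriv_spec hu.exists_weakCovDeriv) p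

theorem MemH1.memLp_rot {u : S2 → E3} (hu : MemH1 u) : MemLp (rot u) 2 area :=
  hu.cross.memLp_div.neg

theorem MemH1.integral_rot_mul {u : S2 → E3} (hu : MemH1 u) (p : Poly) :
    ∫ s, rot u s * pev p s ∂area = -∫ s, inner ℝ (fieldEval (curlField p) s) (u s) ∂area := by
  have h := hu.cross.integral_div_mul p
  simp only [rot, neg_mul, integral_neg, h, neg_neg]
  rw [← integral_neg]
  refine integral_congr_ae (Eventually.of_forall fun s => ?_)
  have h1 := sphere_sum_sq s
  have h2 : pev (normalPoly (curlField p)) s = 0 := by rw [normalPoly_curlField]; simp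
  simp [normalPoly, Fin.sum_univ_three, curlField_apply] at h2
  simp [Fin.sum_univ_three, PiLp.inner_apply, fieldEval_apply, gradField_apply, curlField_apply,
    cross_coord]
  linear_combination (-(pev (angular 0 p) s * u s 0 + pev (angular 1 p) s * u s 1 +
    pev (angular 2 p) s * u s 2)) * h1 +
    ((s : E3) 0 * u s 0 + (s : E3) 1 * u s 1 + (s : E3) 2 * u s 2) * h2

/-! ### Rumin's argument -/

/-- The left side is `∫ 2 σ (r - σ)² dσ` over `[s, s']`, and `(r - σ)²` is largest at the left end.
The substitution `y = r - s`, `z = r - s'` makes the difference visibly nonnegative. -/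
theorem antiderivative_sub_le {r s s' : ℝ} (h0 : 0 ≤ s) (h1 : s ≤ s') (h2 : s' ≤ r) :
    (2 / 3 * r * (r - s) ^ 3 - (r - s) ^ 4 / 2) - (2 / 3 * r * (r - s') ^ 3 - (r - s') ^ 4 / 2) ≤
      (s' ^ 2 - s ^ 2) * (r - s) ^ 2 := by
  obtain ⟨y, rfl⟩ : ∃ y, s = r - y := ⟨r - s, by ring⟩
  obtain ⟨z, rfl⟩ : ∃ z, s' = r - z := ⟨r - s', by ring⟩
  have hz : 0 ≤ z := by linarith
  have hyz : 0 ≤ y - z := by linarith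
  have h : 0 ≤ (y - z) ^ 2 * (2 / 3 * (r - y) * (2 * y + z) + 1 / 6 * (y - z) * (5 * y + 3 * z)) := by
    have : 0 ≤ y := by linarith
    positivity
  nlinarith

/-- A discrete version of `∫ (r - √(a E))₊² dE = r⁴ / (6 a)`. -/
theorem pow_four_le_sum {b r : ℝ} (hb : 0 ≤ b) (hr : 0 ≤ r) (D : ℕ)
    (hD : r ^ 2 ≤ b * (D * (D + 2))) :
    r ^ 4 ≤ 9 * b * ∑ m ∈ Finset.range D,
      2 * ((m : ℝ) + 1) * (max (r - √(b * (m * (m + 2)))) 0) ^ 2 := by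
  -- The bound `m (m + 2) ≤ 3/2 m (m + 1)`, sharp at `m = 1`, replaces `√(b m (m + 2))` by nodes `t
  -- m` with `t (m + 1)² - t m² = 2 a (m + 1)`, matching the weights. The constant is then `6 a = 9
  -- b`.
  set a : ℝ := 3 / 2 * b with ha
  have ha0 : 0 ≤ a := by positivity
  set t : ℕ → ℝ := fun m => √(a * (m * (m + 1))) with ht
  have ht2 (m : ℕ) : t m ^ 2 = a * (m * (m + 1)) := Real.sq_sqrt (by positivity)
  have hτ (m : ℕ) : b * ((m : ℝ) * (m + 2)) ≤ a * (m * (m + 1)) := by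
    rcases Nat.eq_zero_or_pos m with rfl | hm
    · simp
    · have : (1 : ℝ) ≤ m := by exact_mod_cast hm
      have h : (m : ℝ) * (m + 2) ≤ 3 / 2 * (m * (m + 1)) := by nlinarith
      nlinarith
  -- Cutting the nodes off at `r` makes the telescoping sum run from `G 0 = r⁴ / 6` to `G r = 0`;
  -- the hypothesis `hD` ensures that `r` is reached by step `D`.
  set s : ℕ → ℝ := fun m => min (t m) r with hs
  set G : ℝ → ℝ := fun s => 2 / 3 * r * (r - s) ^ 3 - (r - s) ^ 4 / 2 with hG
  have hmono (m : ℕ) : t m ≤ t (m + 1) := by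
    refine Real.sqrt_le_sqrt ?_
    gcongr <;> simp
  have hstep (m : ℕ) : G (s m) - G (s (m + 1)) ≤
      a * (2 * ((m : ℝ) + 1) * (max (r - √(b * (m * (m + 2)))) 0) ^ 2) := by
    have h0 : 0 ≤ s m := le_min (Real.sqrt_nonneg _) hr
    have h1 : s m ≤ s (m + 1) := min_le_min_right _ (hmono m)
    refine (antiderivative_sub_le h0 h1 (min_le_right _ _)).trans ?_
    rcases le_total r (t m) with h | h
    · have : s m = r := min_eq_right h
      rw [this, sub_self]
      simp only [ne_eq, OfNat.ofNat_ne_zero, not_false_eq_true, zero_pow, mul_zero]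
      positivity
    · have h2 : s m = t m := min_eq_left h
      have h3 : s (m + 1) ^ 2 ≤ t (m + 1) ^ 2 :=
        pow_le_pow_left₀ (h0.trans h1) (min_le_left _ _) 2
      have h4 : (r - t m) ^ 2 ≤ (max (r - √(b * (m * (m + 2)))) 0) ^ 2 := by
        refine pow_le_pow_left₀ (by linarith) (le_max_of_le_left ?_) 2
        have := Real.sqrt_le_sqrt (hτ m)
        simp only [ht]
        linarith
      rw [h2]
      have h5 : s (m + 1) ^ 2 - t m ^ 2 ≤ a * (2 * ((m : ℝ) + 1)) := by
        rw [ht2] at h3 ⊢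
        push_cast at h3
        linarith
      calc _ ≤ a * (2 * ((m : ℝ) + 1)) * (r - t m) ^ 2 := by gcongr
        _ ≤ a * (2 * ((m : ℝ) + 1)) * (max (r - √(b * (m * (m + 2)))) 0) ^ 2 := by gcongr
        _ = _ := by ring
  have htel : G (s 0) - G (s D) ≤ ∑ m ∈ Finset.range D,
      a * (2 * ((m : ℝ) + 1) * (max (r - √(b * (m * (m + 2)))) 0) ^ 2) := by
    rw [← Finset.sum_range_sub' (fun m => G (s m)) D]
    exact Finset.sum_le_sum fun m _ => hstep m
  have hs0 : s 0 = 0 := by simp [hs, ht, hr]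
  have hsD : s D = r := min_eq_right (Real.le_sqrt_of_sq_le (hD.trans (hτ D)))
  rw [hs0, hsD, ← Finset.mul_sum] at htel
  simp only [hG, sub_zero, sub_self] at htel
  have : 9 * b = 6 * a := by rw [ha]; ring
  rw [this]
  linarith

/-- Rumin's argument: a bound on the densities of all partial sums yields an `L⁴` bound. -/
theorem integral_norm_pow_four_le {H : Type*} [NormedAddCommGroup H]
    {S : ℕ → S2 → H} (hS : ∀ m, Continuous (S m)) {b : ℝ} (hb : 0 ≤ b)
    (hbound : ∀ m s, ‖S m s‖ ^ 2 ≤ b * (m * (m + 2))) (D : ℕ) :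
    ∫ s, ‖S D s‖ ^ 4 ∂area ≤ 9 * b * ∑ m ∈ Finset.range D,
      2 * ((m : ℝ) + 1) * ∫ s, ‖S D s - S m s‖ ^ 2 ∂area := by
  have hi (m : ℕ) : Integrable (fun s => 2 * ((m : ℝ) + 1) * ‖S D s - S m s‖ ^ 2) area :=
    integrable_of_continuous (continuous_const.mul (((hS D).sub (hS m)).norm.pow 2))
  simp only [← integral_const_mul]
  rw [← integral_finsetSum _ fun m _ => hi m, ← integral_const_mul]
  refine integral_mono (integrable_of_continuous ((hS D).norm.pow 4))
    ((integrable_finsetSum _ fun m _ => hi m).const_mul _) fun s => ?_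
  refine (pow_four_le_sum hb (norm_nonneg _) D (hbound D s)).trans ?_
  gcongr with m hm
  refine max_le ?_ (norm_nonneg _)
  have h1 : ‖S m s‖ ≤ √(b * (m * (m + 2))) := Real.le_sqrt_of_sq_le (hbound m s)
  have h2 := norm_sub_norm_le (S D s) (S m s)
  linarith

/-! ### The inequality for finite projections -/

/-- Linear combinations of vector spherical harmonics. -/
def harmSum (t : Finset (Bool × HarmIdx)) (c : Bool × HarmIdx → ℝ) : Fin 3 → Poly :=
  ∑ α ∈ t, c α • vecHarm α.1 α.2.1 α.2.2

theorem vecL2_harmSum (t : Finset (Bool × HarmIdx)) (c : Bool × HarmIdx → ℝ) :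
    vecL2 (harmSum t c) = ∑ α ∈ t, c α • vecHarmL2 α := by
  simp [harmSum, vecHarmL2]

theorem fieldEval_harmSum_apply (t : Finset (Bool × HarmIdx)) (c : Bool × HarmIdx → ℝ) (s : S2)
    (i : Fin 3) : fieldEval (harmSum t c) s i =
      ∑ α ∈ t, c α * fieldEval (vecHarm α.1 α.2.1 α.2.2) s i := by
  simp [harmSum, fieldEval_apply, Finset.sum_apply]

theorem integral_norm_sq_harmSum (t : Finset (Bool × HarmIdx)) (c : Bool × HarmIdx → ℝ) :
    ∫ s, ‖fieldEval (harmSum t c) s‖ ^ 2 ∂area = ∑ α ∈ t, c α ^ 2 := by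
  simp only [norm_sq_fieldEval]
  change sphereInt _ = _
  rw [← inner_vecL2, vecL2_harmSum, orthonormal_vecHarmL2.inner_sum]
  simp [sq]

theorem fieldEval_harmSum_sub {t t' : Finset (Bool × HarmIdx)} (h : t' ⊆ t)
    (c : Bool × HarmIdx → ℝ) (s : S2) :
    fieldEval (harmSum t c) s - fieldEval (harmSum t' c) s = fieldEval (harmSum (t \ t') c) s := by
  ext i
  rw [PiLp.sub_apply, fieldEval_harmSum_apply, fieldEval_harmSum_apply, fieldEval_harmSum_apply,
    ← Finset.sum_sdiff h, add_sub_cancel_right]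

/-- The pointwise bound on the density of projections of an orthonormal family. -/
theorem sum_norm_sq_harmSum_le {N : ℕ} {U : Fin N → Lp E3 2 area} (hU : Orthonormal ℝ U)
    (t : Finset (Bool × HarmIdx)) (s : S2) :
    ∑ j, ‖fieldEval (harmSum t fun α => inner ℝ (vecHarmL2 α) (U j)) s‖ ^ 2 ≤
      ∑ α ∈ t, ‖fieldEval (vecHarm α.1 α.2.1 α.2.2) s‖ ^ 2 := by
  simp only [EuclideanSpace.norm_sq_eq]
  rw [Finset.sum_comm, Finset.sum_comm (s := t)]
  refine Finset.sum_le_sum fun i _ => ?_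
  set w : Bool × HarmIdx → ℝ := fun α => fieldEval (vecHarm α.1 α.2.1 α.2.2) s i with hw
  -- For a fixed point and component, evaluating the projection of `U j` is pairing `U j` with the
  -- kernel `∑ w α • vecHarmL2 α`, so Bessel's inequality for `U` applies to this kernel.
  have h := hU.sum_inner_products_le (∑ α ∈ t, w α • vecHarmL2 α) (s := Finset.univ)
  rw [← real_inner_self_eq_norm_sq, orthonormal_vecHarmL2.inner_sum] at h
  refine le_trans (le_of_eq ?_) (h.trans (le_of_eq ?_))
  · refine Finset.sum_congr rfl fun j _ => ?_
    rw [fieldEval_harmSum_apply, inner_sum]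
    congr 2
    refine Finset.sum_congr rfl fun α _ => ?_
    rw [inner_smul_right, real_inner_comm, mul_comm]
  · refine Finset.sum_congr rfl fun α _ => ?_
    simp [hw, sq]

theorem sum_range_succ_mul_two (n : ℕ) :
    ∑ m ∈ Finset.range (n + 1), 2 * ((m : ℝ) + 1) = eig n := by
  induction n with
  | zero => simp [eig]
  | succ n ih => rw [Finset.sum_range_succ, ih]; simp only [eig]; push_cast; ring

/-- Summation by parts: an index `n < D` is outside `harmFinset m` exactly when `m ≤ n`, and the
weights `2 (m + 1)` over these `m` add up to `eig n`. -/
theorem sum_mul_sum_sdiff (B : Finset Bool) (D : ℕ) (γ : Bool × HarmIdx → ℝ) :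
    ∑ m ∈ Finset.range D, 2 * ((m : ℝ) + 1) *
      ∑ α ∈ (B ×ˢ harmFinset D) \ (B ×ˢ harmFinset m), γ α =
      ∑ α ∈ B ×ˢ harmFinset D, eig α.2.1 * γ α := by
  simp only [Finset.mul_sum]
  rw [Finset.sum_comm' (t' := B ×ˢ harmFinset D) (s' := fun α => Finset.range (α.2.1 + 1))]
  · refine Finset.sum_congr rfl fun α _ => ?_
    rw [← Finset.sum_mul, sum_range_succ_mul_two]
  · intro m α
    simp only [harmFinset, Finset.mem_range, Finset.mem_sdiff, Finset.mem_product,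
      Finset.mem_sigma, Finset.mem_univ, and_true]
    constructor
    · rintro ⟨h1, ⟨h2, h3⟩, h4⟩
      refine ⟨?_, h2, h3⟩
      by_contra h
      exact h4 ⟨h2, by omega⟩
    · rintro ⟨h1, h2, h3⟩
      exact ⟨by omega, ⟨h2, h3⟩, fun h => by omega⟩

theorem harmFinset_mono {m n : ℕ} (h : m ≤ n) : harmFinset m ⊆ harmFinset n :=
  Finset.sigma_mono (Finset.range_mono h) fun _ => subset_rfl

/-- The Lieb-Thirring inequality for the projections of an orthonormal family. -/
theorem integral_density_harmSum_le {N : ℕ} {U : Fin N → Lp E3 2 area} (hU : Orthonormal ℝ U)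
    (B : Finset Bool) (D : ℕ) :
    ∫ s, (∑ j, ‖fieldEval (harmSum (B ×ˢ harmFinset D)
      fun α => inner ℝ (vecHarmL2 α) (U j)) s‖ ^ 2) ^ 2 ∂area ≤
      9 * (B.card / (4 * Real.pi)) * ∑ j, ∑ α ∈ B ×ˢ harmFinset D,
        eig α.2.1 * (inner ℝ (vecHarmL2 α) (U j)) ^ 2 := by
  set F : ℕ → Fin N → S2 → E3 := fun m j =>
    fieldEval (harmSum (B ×ˢ harmFinset m) fun α => inner ℝ (vecHarmL2 α) (U j)) with hF
  -- Stacking the `N` fields into one vector makes the density a squared norm, so that Rumin's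
  -- argument treats the whole family at once.
  set S : ℕ → S2 → PiLp 2 (fun _ : Fin N => E3) := fun m s => WithLp.toLp 2 fun j => F m j s with hS
  have hcont (m : ℕ) (j : Fin N) : Continuous (F m j) := continuous_fieldEval _
  have hSn (m : ℕ) (s : S2) : ‖S m s‖ ^ 2 = ∑ j, ‖F m j s‖ ^ 2 := PiLp.norm_sq_eq_of_L2 _ _
  have hb : 0 ≤ (B.card : ℝ) / (4 * Real.pi) := by positivity
  have h := integral_norm_pow_four_le (S := S)
    (fun m => (PiLp.continuous_toLp 2 _).comp (continuous_pi fun j => hcont m j)) hb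
    (fun m s => by
      rw [hSn]
      exact (sum_norm_sq_harmSum_le hU _ s).trans (sum_norm_sq_vecHarm_le B m s)) D
  have h1 (s : S2) : ‖S D s‖ ^ 4 = (∑ j, ‖F D j s‖ ^ 2) ^ 2 := by
    rw [← hSn]; ring
  simp only [h1] at h
  refine h.trans (le_of_eq ?_)
  congr 1
  rw [Finset.sum_congr rfl fun j _ => (sum_mul_sum_sdiff B D
    fun α => (inner ℝ (vecHarmL2 α) (U j)) ^ 2).symm, Finset.sum_comm]
  refine Finset.sum_congr rfl fun m hm => ?_
  rw [← Finset.mul_sum]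
  congr 1
  have h2 (s : S2) : ‖S D s - S m s‖ ^ 2 = ∑ j, ‖F D j s - F m j s‖ ^ 2 :=
    PiLp.norm_sq_eq_of_L2 _ _
  simp only [h2]
  have hi (j : Fin N) : Integrable (fun s => ‖F D j s - F m j s‖ ^ 2) area :=
    integrable_of_continuous (((hcont D j).sub (hcont m j)).norm.pow 2)
  rw [integral_finsetSum _ fun j _ => hi j]
  refine Finset.sum_congr rfl fun j _ => ?_
  have hsub : B ×ˢ harmFinset m ⊆ B ×ˢ harmFinset D :=
    Finset.product_subset_product_right (harmFinset_mono (Finset.mem_range.1 hm).le)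
  simp only [hF, fieldEval_harmSum_sub hsub]
  exact integral_norm_sq_harmSum _ _

/-! ### Passage to fields in `H¹` -/

/-- If the products of `f` with the eigenfunctions are, up to sign, the inner products of `u`
with potential fields, then the corresponding part of the Dirichlet energy of `u` is bounded by
the square of the norm of `f`. -/
theorem sum_eig_mul_le_normSq {u : S2 → E3} (hu : MemLp u 2 area) {f : S2 → ℝ}
    (hf : MemLp f 2 area) (b : Bool)
    (h : ∀ p : Poly, ∫ s, f s * pev p s ∂area =
      -∫ s, inner ℝ (fieldEval (potField b p) s) (u s) ∂area) (t : Finset HarmIdx) :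
    ∑ α ∈ t, eig α.1 * (inner ℝ (vecHarmL2 (b, α)) (hu.toLp u)) ^ 2 ≤ normSq f := by
  -- The normalization `(√eig)⁻¹` of the vector harmonics cancels the eigenvalue, leaving the
  -- squared coefficient of `f`; Bessel's inequality for the scalar harmonics concludes.
  have h1 (α : HarmIdx) : eig α.1 * (inner ℝ (vecHarmL2 (b, α)) (hu.toLp u)) ^ 2 =
      ‖inner ℝ (harmL2 α) (hf.toLp f)‖ ^ 2 := by
    have h2 : inner ℝ (harmL2 α) (hf.toLp f) =
        ∫ s, f s * pev (harmPoly α.1 α.2) s ∂area := by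
      rw [L2.inner_def]
      refine integral_congr_ae ?_
      filter_upwards [coeFn_toL2 (harmPoly α.1 α.2), hf.coeFn_toLp] with s h3 h4
      rw [harmL2, h3, h4]
      simp
    have he := eig_pos α.1
    rw [h2, h, ← inner_vecL2_toLp _ hu]
    simp only [vecHarmL2, vecHarm, map_smul, real_inner_smul_left, Real.norm_eq_abs, sq_abs]
    rw [mul_pow, inv_pow, Real.sq_sqrt he.le, ← mul_assoc, mul_inv_cancel₀ he.ne']
    ring
  have h5 : ‖hf.toLp f‖ ^ 2 = normSq f := by
    rw [← real_inner_self_eq_norm_sq, L2.inner_def, normSq]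
    refine integral_congr_ae ?_
    filter_upwards [hf.coeFn_toLp] with s h4
    rw [h4]
    simp [sq]
  simp only [h1, ← h5]
  exact orthonormal_harmL2.sum_inner_products_le _

theorem inner_vecHarmL2_eq_zero {u : S2 → E3} (hu : MemLp u 2 area) {f : S2 → ℝ}
    (b : Bool) (h : ∀ p : Poly, ∫ s, f s * pev p s ∂area =
      -∫ s, inner ℝ (fieldEval (potField b p) s) (u s) ∂area) (hf : ∀ᵐ s ∂area, f s = 0)
    (α : HarmIdx) : inner ℝ (vecHarmL2 (b, α)) (hu.toLp u) = 0 := by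
  have h0 : ∫ s, f s * pev (harmPoly α.1 α.2) s ∂area = 0 := by
    refine integral_eq_zero_of_ae ?_
    filter_upwards [hf] with s hs
    simp [hs]
  rw [h, ← inner_vecL2_toLp _ hu, neg_eq_zero] at h0
  simp only [vecHarmL2, vecHarm, map_smul, real_inner_smul_left]
  rw [h0, mul_zero]

theorem orthonormal_toLp {N : ℕ} {u : Fin N → S2 → E3} (hm : ∀ j, MemLp (u j) 2 area)
    (hu : IsOrthonormal u) : Orthonormal ℝ fun j => (hm j).toLp (u j) := by
  rw [orthonormal_iff_ite]
  intro i j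
  rw [← hu i j, L2.inner_def]
  refine integral_congr_ae ?_
  filter_upwards [(hm i).coeFn_toLp, (hm j).coeFn_toLp] with s h1 h2
  rw [h1, h2]

/-- Fatou's lemma for squared densities of approximations converging in `L²`. -/
theorem integrable_density_sq_of_tendsto {N : ℕ} {u : Fin N → S2 → E3}
    (hm : ∀ j, MemLp (u j) 2 area) {F : ℕ → Fin N → S2 → E3} (hF : ∀ D j, Continuous (F D j))
    (ht : ∀ j, Tendsto (fun D => eLpNorm (F D j - u j) 2 area) atTop (𝓝 0)) {K : ℝ}
    (hK : ∀ D, ∫ s, (∑ j, ‖F D j s‖ ^ 2) ^ 2 ∂area ≤ K) :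
    Integrable (fun s => density u s ^ 2) area ∧ ∫ s, density u s ^ 2 ∂area ≤ K := by
  have hmF (D : ℕ) (j : Fin N) : AEStronglyMeasurable (fun s => ‖(F D j - u j) s‖) area :=
    ((hF D j).aestronglyMeasurable.sub (hm j).aestronglyMeasurable).norm
  -- One scalar error dominating all `j` yields a single subsequence along which every component
  -- converges almost everywhere.
  set h : ℕ → S2 → ℝ := fun D s => ∑ j, ‖(F D j - u j) s‖ with hh
  have hlim : Tendsto (fun D => eLpNorm (h D - 0) 2 area) atTop (𝓝 0) := by
    have hsum : Tendsto (fun D => ∑ j, eLpNorm (F D j - u j) 2 area) atTop (𝓝 0) := by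
      simpa using tendsto_finsetSum Finset.univ fun j _ => ht j
    refine tendsto_of_tendsto_of_tendsto_of_le_of_le tendsto_const_nhds hsum
      (fun _ => bot_le) fun D => ?_
    have e : h D - 0 = ∑ j, fun s => ‖(F D j - u j) s‖ := by
      ext s; simp [hh, Finset.sum_apply]
    rw [e]
    refine (eLpNorm_sum_le (fun j _ => hmF D j) (by norm_num)).trans (le_of_eq ?_)
    exact Finset.sum_congr rfl fun j _ => eLpNorm_norm _
  have hmeas := tendstoInMeasure_of_tendsto_eLpNorm (by norm_num : (2 : ENNReal) ≠ 0)
    (fun D => Finset.aestronglyMeasurable_fun_sum _ fun j _ => hmF D j)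
    aestronglyMeasurable_zero hlim
  obtain ⟨ns, -, hns⟩ := hmeas.exists_seq_tendsto_ae
  have hae : ∀ᵐ s ∂area, Tendsto (fun k => (∑ j, ‖F (ns k) j s‖ ^ 2) ^ 2) atTop
      (𝓝 (density u s ^ 2)) := by
    filter_upwards [hns] with s hs
    refine (tendsto_finsetSum _ fun j _ => ?_).pow 2
    refine (Tendsto.norm ?_).pow 2
    rw [tendsto_iff_norm_sub_tendsto_zero]
    refine squeeze_zero (fun _ => norm_nonneg _) (fun k => ?_) hs
    exact Finset.single_le_sum (f := fun j => ‖(F (ns k) j - u j) s‖)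
      (fun _ _ => norm_nonneg _) (Finset.mem_univ j)
  have hK0 : 0 ≤ K := (integral_nonneg fun s => by positivity).trans (hK 0)
  have hcont (D : ℕ) : Continuous fun s => (∑ j, ‖F D j s‖ ^ 2) ^ 2 :=
    (continuous_finsetSum _ fun j _ => (hF D j).norm.pow 2).pow 2
  have hfatou : ∫⁻ s, ENNReal.ofReal (density u s ^ 2) ∂area ≤ ENNReal.ofReal K := by
    calc ∫⁻ s, ENNReal.ofReal (density u s ^ 2) ∂area
        = ∫⁻ s, liminf (fun k => ENNReal.ofReal ((∑ j, ‖F (ns k) j s‖ ^ 2) ^ 2)) atTop ∂area := by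
          refine lintegral_congr_ae ?_
          filter_upwards [hae] with s hs
          exact ((ENNReal.continuous_ofReal.tendsto _).comp hs).liminf_eq.symm
      _ ≤ liminf (fun k => ∫⁻ s, ENNReal.ofReal ((∑ j, ‖F (ns k) j s‖ ^ 2) ^ 2) ∂area) atTop :=
          lintegral_liminf_le fun k =>
            (ENNReal.continuous_ofReal.comp (hcont (ns k))).measurable
      _ ≤ ENNReal.ofReal K := by
          refine liminf_le_of_le (by isBoundedDefault) fun c hc => ?_
          obtain ⟨k, hk⟩ := hc.exists
          refine hk.trans ?_
          rw [← ofReal_integral_eq_lintegral_ofReal (integrable_of_continuous (hcont (ns k)))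
            (Eventually.of_forall fun s => by positivity)]
          exact ENNReal.ofReal_le_ofReal (hK _)
  have hmd : AEStronglyMeasurable (fun s => density u s ^ 2) area :=
    (Finset.aestronglyMeasurable_fun_sum _ fun j _ => (hm j).aestronglyMeasurable.norm.pow 2).pow 2
  have hpos : 0 ≤ᵐ[area] fun s => density u s ^ 2 := Eventually.of_forall fun s => sq_nonneg _
  refine ⟨⟨hmd, ?_⟩, ?_⟩
  · rw [hasFiniteIntegral_iff_ofReal hpos]
    exact hfatou.trans_lt ENNReal.ofReal_lt_top
  · rw [integral_eq_lintegral_of_nonneg_ae hpos hmd]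
    exact ENNReal.toReal_le_of_le_ofReal hK0 hfatou

/-- The collective inequality for families whose expansion involves only the kinds of vector
spherical harmonics in `B`. -/
theorem integrable_density_sq_and_le {N : ℕ} {u : Fin N → S2 → E3} (hH1 : ∀ j, MemH1 (u j))
    (hu : IsOrthonormal u) (B : Finset Bool)
    (hB : ∀ b ∉ B, ∀ (α : HarmIdx) j, inner ℝ (vecHarmL2 (b, α)) ((hH1 j).memLp.toLp (u j)) = 0)
    {E : Bool → Fin N → ℝ}
    (hE : ∀ b j (t : Finset HarmIdx),
      ∑ α ∈ t, eig α.1 * (inner ℝ (vecHarmL2 (b, α)) ((hH1 j).memLp.toLp (u j))) ^ 2 ≤ E b j) :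
    Integrable (fun s => density u s ^ 2) area ∧
      ∫ s, density u s ^ 2 ∂area ≤ 9 * (B.card / (4 * Real.pi)) * ∑ j, ∑ b ∈ B, E b j := by
  set U : Fin N → Lp E3 2 area := fun j => (hH1 j).memLp.toLp (u j) with hU
  have ho : Orthonormal ℝ U := orthonormal_toLp (fun j => (hH1 j).memLp) hu
  refine integrable_density_sq_of_tendsto (fun j => (hH1 j).memLp)
    (F := fun D j => fieldEval (harmSum (B ×ˢ harmFinset D)
      fun α => inner ℝ (vecHarmL2 α) (U j))) (fun D j => continuous_fieldEval _)
    (fun j => ?_) fun D => ?_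
  · have h := tendsto_vecHarm_expansion (hH1 j).memLp (hH1 j).tangent
    have e (D : ℕ) : ∑ α ∈ Finset.univ ×ˢ harmFinset D, inner ℝ (vecHarmL2 α) (U j) • vecHarmL2 α =
        (memLp_of_continuous (continuous_fieldEval (harmSum (B ×ˢ harmFinset D)
          fun α => inner ℝ (vecHarmL2 α) (U j)))).toLp _ := by
      change _ = vecL2 _
      rw [vecL2_harmSum]
      -- The full expansion converges to `u j`; by `hB` the kinds outside `B` contribute nothing.
      refine (Finset.sum_subset
        (Finset.product_subset_product_left (Finset.subset_univ B)) fun α h1 h2 => ?_).symm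
      simp only [Finset.mem_product, not_and] at h1 h2
      rw [hB α.1 (fun h3 => h2 h3 h1.2) α.2 j, zero_smul]
    rw [funext e] at h
    exact (Lp.tendsto_Lp_iff_tendsto_eLpNorm'' _ _ _ _).1 h
  · refine (integral_density_harmSum_le ho B D).trans ?_
    gcongr with j _
    rw [Finset.sum_product]
    exact Finset.sum_le_sum fun b _ => hE b j _

end SphereLT

end

theorem theorem2p2 (N : ℕ) (u : Fin N → SphereLT.S2 → SphereLT.E3)
    (hH1 : ∀ j, SphereLT.MemH1 (u j)) (hu : SphereLT.IsOrthonormal u) :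
    MeasureTheory.Integrable (fun s => SphereLT.density u s ^ 2) SphereLT.area ∧
    ∫ s, SphereLT.density u s ^ 2 ∂SphereLT.area ≤
      9 / (2 * Real.pi) *
        ∑ j, (SphereLT.normSq (SphereLT.rot (u j)) + SphereLT.normSq (SphereLT.div (u j))) ∧
    ((∀ j, ∀ᵐ s ∂SphereLT.area, SphereLT.div (u j) s = 0) →
      ∫ s, SphereLT.density u s ^ 2 ∂SphereLT.area ≤
        9 / (4 * Real.pi) * ∑ j, SphereLT.normSq (SphereLT.rot (u j))) ∧
    ((∀ j, ∀ᵐ s ∂SphereLT.area, SphereLT.rot (u j) s = 0) →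
      ∫ s, SphereLT.density u s ^ 2 ∂SphereLT.area ≤
        9 / (4 * Real.pi) * ∑ j, SphereLT.normSq (SphereLT.div (u j))) := by
  have hE (b : Bool) (j : Fin N) (t : Finset SphereLT.HarmIdx) :
      ∑ α ∈ t, SphereLT.eig α.1 *
        (inner ℝ (SphereLT.vecHarmL2 (b, α)) ((hH1 j).memLp.toLp (u j))) ^ 2 ≤
      SphereLT.normSq (if b then SphereLT.div (u j) else SphereLT.rot (u j)) := by
    cases b
    · exact SphereLT.sum_eig_mul_le_normSq (hH1 j).memLp (hH1 j).memLp_rot false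
        (hH1 j).integral_rot_mul t
    · exact SphereLT.sum_eig_mul_le_normSq (hH1 j).memLp (hH1 j).memLp_div true
        (hH1 j).integral_div_mul t
  have hall := SphereLT.integrable_density_sq_and_le hH1 hu Finset.univ
    (fun b hb => absurd (Finset.mem_univ b) hb) hE
  refine ⟨hall.1, hall.2.trans (le_of_eq ?_), fun hdiv => ?_, fun hrot => ?_⟩
  · simp only [Fintype.sum_bool, Finset.card_univ, Fintype.card_bool, if_true,
      Bool.false_eq_true, if_false]
    congr 1
    · push_cast
      ring
    · exact Finset.sum_congr rfl fun j _ => add_comm _ _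
  -- Without divergence the gradient coefficients vanish, so only the rotated gradients count and
  -- the constant is halved.
  · refine (SphereLT.integrable_density_sq_and_le hH1 hu {false} (fun b hb α j => ?_)
      hE).2.trans (le_of_eq ?_)
    · obtain rfl : b = true := by simpa using hb
      exact SphereLT.inner_vecHarmL2_eq_zero (hH1 j).memLp true (hH1 j).integral_div_mul
        (hdiv j) α
    · simp [div_eq_mul_inv]
  · refine (SphereLT.integrable_density_sq_and_le hH1 hu {true} (fun b hb α j => ?_)
      hE).2.trans (le_of_eq ?_)
    · obtain rfl : b = false := by simpa using hb
      exact SphereLT.inner_vecHarmL2_eq_zero (hH1 j).memLp false (hH1 j).integral_rot_mul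
        (hrot j) α
    · simp [div_eq_mul_inv]
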